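/- **Almost conservation law for the fifth order KdV–BBM equation.** Let $\gamma_1,\delta_1>0$, $\gamma_2,\delta_2\in\mathbb R$ and $\gamma=\frac{7}{48}$, and consider for real-valued $\eta=\eta(x,t)$ the Cauchy problem $$\partial_t\eta+\partial_x\eta-\gamma_1\partial_t\partial_x^2\eta+\gamma_2\partial_x^3\eta+\delta_1\partial_t\partial_x^4\eta+\delta_2\partial_x^5\eta=-\tfrac34\partial_x(\eta^2)-\gamma\,\partial_x^3(\eta^2)+\tfrac{7}{48}\partial_x\big((\partial_x\eta)^2\big)+\tfrac18\partial_x(\eta^3),\qquad \eta(x,0)=\eta_0(x),$$ the equation being understood in the sense of tempered distributions in $x$ for every $t$. For $\sigma\ge 0$ let $H^{\sigma,2}(\mathbb R)$ be the space of real-valued $f\in L^2(\mathbb R)$ with finite norm $\|f\|_{H^{\sigma,2}}=\|\cosh(\sigma|\xi|)(1+\xi^2)\widehat f(\xi)\|_{L^2_\xi}$ (with the unitary Fourier transform), let $D=-i\partial_x$, $v_\sigma=\cosh(\sigma|D|)\eta$, and define the modified energy $$E_\sigma(t)=\frac12\int_{\mathbb R}v_\sigma^2+\gamma_1(\partial_xv_\sigma)^2+\delta_1(\partial_x^2v_\sigma)^2\,dx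 .$$ Then there are constants $c_0,C>0$, depending only on $\gamma_1,\gamma_2,\delta_1,\delta_2$, such that the following holds for all $\sigma\ge0$ and $\eta_0\in H^{\sigma,2}(\mathbb R)$: if $0<T\le c_0\,(1+\|\eta_0\|_{H^{\sigma,2}})^{-2}$ and $\eta\in C([0,T];H^{\sigma,2}(\mathbb R))$ is a solution of the Cauchy problem on $[0,T]$, then $\sup_{0\le t\le T}E_\sigma(t)$ is finite and $$\Big|\sup_{0\le t\le T}E_\sigma(t)-E_\sigma(0)\Big|\le C\,\sigma^2\,T\,\big(1+E_\sigma(0)^{1/2}\big)E_\sigma(0)^{3/2}.$$ -/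

import Mathlib

open MeasureTheory Filter Topology Set
open scoped FourierTransform SchwartzMap

noncomputable section

namespace KdVBBM

/-- Real-valued square-integrable functions on the line. -/
abbrev L2 : Type := Lp ℝ 2 (volume : Measure ℝ)

/-- The `L²` Fourier transform of a real-valued function, with Mathlib's normalization
`𝓕 f ξ = ∫ exp (-2πi x ξ) f x dx`. In this normalization the operator `D = -i ∂ₓ` has the
symbol `2πξ`, and Plancherel's identity has constant one. -/
def hat (f : L2) : Lp ℂ 2 (volume : Measure ℝ) :=
  𝓕 (Complex.ofRealCLM.compLp f)

/-- The domain condition of the operator `m(D)`: `m(2πξ) 𝓕 f (ξ)` is square-integrable. -/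
def InDomain (m : ℝ → ℂ) (f : L2) : Prop :=
  MemLp (fun ξ : ℝ => m (2 * Real.pi * ξ) * hat f ξ) 2 volume

open Classical in
/-- The Fourier multiplier operator `m(D)`, for symbols with `m (-ξ) = conj (m ξ)`, which map
real-valued functions to real-valued functions (so that taking the real part changes nothing).
Off its domain it is given the value `0`. -/
def multiplier (m : ℝ → ℂ) (f : L2) : L2 :=
  if h : InDomain m f then Complex.reCLM.compLp (𝓕⁻ (h.toLp _)) else 0

/-- The derivative `∂ₓ = i D`. -/
def dx (f : L2) : L2 := multiplier (fun ξ => Complex.I * ξ) f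

/-- The operator `cosh(σ|D|)`. -/
def coshD (σ : ℝ) (f : L2) : L2 := multiplier (fun ξ => (Real.cosh (σ * |ξ|) : ℝ)) f

/-- The weight `cosh(σ|ξ|) ⟨ξ⟩ˢ`, where `⟨ξ⟩ = (1 + ξ²)^{1/2}`. -/
def weight (σ s ξ : ℝ) : ℝ := Real.cosh (σ * |ξ|) * (Real.sqrt (1 + ξ ^ 2)) ^ s

/-- Membership in the modified Gevrey space `H^{σ,s}(ℝ)` (for `s ≥ 0`). -/
def MemH (σ s : ℝ) (f : L2) : Prop := InDomain (fun ξ => (weight σ s ξ : ℂ)) f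

/-- The norm of `H^{σ,s}(ℝ)`. -/
def normH (σ s : ℝ) (f : L2) : ℝ :=
  (eLpNorm (fun ξ : ℝ => (weight σ s (2 * Real.pi * ξ) : ℂ) * hat f ξ) 2 volume).toReal

/-- `η ∈ C([0,T]; H^{σ,s}(ℝ))`. -/
def ContInH (σ s T : ℝ) (η : ℝ → L2) : Prop :=
  ∀ t ∈ Icc 0 T, MemH σ s (η t) ∧
    Tendsto (fun r => normH σ s (η r - η t)) (𝓝[Icc 0 T] t) (𝓝 0)

/-- `η` solves, on the time interval `[0,T]`,
`∂ₜη + ∂ₓη - γ₁ ∂ₜ∂ₓ²η + γ₂ ∂ₓ³η + δ₁ ∂ₜ∂ₓ⁴η + δ₂ ∂ₓ⁵η`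
`  = -(3/4) ∂ₓ(η²) - γ ∂ₓ³(η²) + (7/48) ∂ₓ((∂ₓη)²) + (1/8) ∂ₓ(η³)`, `η(0) = η₀`,
the equation being understood in the sense of tempered distributions in `x`, at every time. -/
structure IsSolution (γ γ₁ γ₂ δ₁ δ₂ T : ℝ) (η₀ : L2) (η : ℝ → L2) : Prop where
  initial : η 0 = η₀
  equation : ∀ φ : 𝓢(ℝ, ℝ), ∀ t ∈ Icc 0 T,
    HasDerivWithinAt
      (fun r => ∫ x, η r x * (φ x - γ₁ * iteratedDeriv 2 φ x + δ₁ * iteratedDeriv 4 φ x))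
      ((∫ x, η t x * (deriv φ x + γ₂ * iteratedDeriv 3 φ x + δ₂ * iteratedDeriv 5 φ x))
        + (3 / 4) * (∫ x, (η t x) ^ 2 * deriv φ x)
        + γ * (∫ x, (η t x) ^ 2 * iteratedDeriv 3 φ x)
        - (7 / 48) * (∫ x, (dx (η t) x) ^ 2 * deriv φ x)
        - (1 / 8) * (∫ x, (η t x) ^ 3 * deriv φ x))
      (Icc 0 T) t

/-- The modified energy
`½ ∫ v² + γ₁ (∂ₓv)² + δ₁ (∂ₓ²v)² dx` of `f`, where `v = cosh(σ|D|) f`. -/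
def energy (γ₁ δ₁ σ : ℝ) (f : L2) : ℝ :=
  (1 / 2) * ∫ x, ((coshD σ f x) ^ 2 + γ₁ * (dx (coshD σ f) x) ^ 2
    + δ₁ * (dx (dx (coshD σ f)) x) ^ 2)

end KdVBBM

end

/-!
On the Fourier side the linear terms of the equation are skew, so the modified energy changes only
through the cubic and quartic interactions. For `σ = 0` these integrate to zero: the quartic one is
an exact derivative, and in the cubic one the coefficient `γ = 7/48` is the one which makes the
terms with three derivatives cancel. For `σ > 0` one compares `cosh(σ|D|)` of a product with the
product of the factors `cosh(σ|D|)`; each commutator gains `sinh` of two frequencies, hence a factor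
`min 1 σ ^ 2` at the cost of two derivatives, which the `H²` norm absorbs. The energy is thus almost
conserved with respect to the `H^{σ,2}` norm, and a continuity argument on the stated time interval
keeps this norm comparable with its initial value. Since the equation holds only in the sense of
distributions, the energy balance is derived for frequency-truncated energies first.
-/

noncomputable section

namespace KdVBBM

open scoped ComplexConjugate ContDiff

local notation "‖" f "‖₂" => lpNorm f 2 (volume : Measure ℝ)

theorem sq_lpNorm_two {α E : Type*} [MeasurableSpace α] {μ : Measure α} [NormedAddCommGroup E]
    {f : α → E} (hf : MemLp f 2 μ) : lpNorm f 2 μ ^ 2 = ∫ x, ‖f x‖ ^ 2 ∂μ := by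
  rw [lpNorm_eq_integral_norm_rpow_toReal two_ne_zero ENNReal.ofNat_ne_top hf.1,
    ENNReal.toReal_ofNat, ← Real.rpow_mul_natCast (by positivity)]
  norm_num

/-! ### The Fourier transform of real-valued functions -/

theorem integral_mul_fourier (F : Lp ℂ 2 (volume : Measure ℝ)) (θ : 𝓢(ℝ, ℂ)) :
    ∫ ξ, θ ξ * 𝓕 F ξ = ∫ x, 𝓕 (θ : ℝ → ℂ) x * F x := by
  have h := DFunLike.congr_fun (Lp.fourier_toTemperedDistribution_eq F) θ
  simp only [TemperedDistribution.fourier_apply, Lp.toTemperedDistribution_apply,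
    smul_eq_mul] at h
  exact h.symm

theorem ae_eq_of_integral_schwartz_mul_eq {F G : ℝ → ℂ} (hF : LocallyIntegrable F)
    (hG : LocallyIntegrable G) (h : ∀ θ : 𝓢(ℝ, ℂ), ∫ x, θ x * F x = ∫ x, θ x * G x) :
    F =ᵐ[volume] G :=
  ae_eq_of_integral_contDiff_smul_eq hF hG fun ψ hψ hc =>
    h (HasCompactSupport.toSchwartzMap (f := fun x => (ψ x : ℂ))
      (hc.comp_left Complex.ofReal_zero) (Complex.ofRealCLM.contDiff.comp hψ))

/-- The conjugate reflection `x ↦ conj (θ (-x))`, whose Fourier transform is the conjugate of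
that of `θ`. -/
def conjNeg (θ : 𝓢(ℝ, ℂ)) : 𝓢(ℝ, ℂ) :=
  SchwartzMap.postcompCLM (𝕜 := ℝ) Complex.conjCLE.toContinuousLinearMap
    (SchwartzMap.compCLMOfContinuousLinearEquiv ℝ (ContinuousLinearEquiv.neg ℝ) θ)

theorem conjNeg_apply (θ : 𝓢(ℝ, ℂ)) (x : ℝ) : conjNeg θ x = conj (θ (-x)) := rfl

theorem fourier_conjNeg (θ : 𝓢(ℝ, ℂ)) (x : ℝ) :
    𝓕 (conjNeg θ : ℝ → ℂ) x = conj (𝓕 (θ : ℝ → ℂ) x) := by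
  rw [Real.fourier_real_eq, Real.fourier_real_eq, ← integral_conj, ← integral_neg_eq_self]
  simp [conjNeg_apply, Circle.smul_def, AddChar.map_neg_eq_inv]

theorem fourier_conj_ae {F G : Lp ℂ 2 (volume : Measure ℝ)} (h : ∀ᵐ x, G x = conj (F x)) :
    ∀ᵐ ξ, 𝓕 G ξ = conj (𝓕 F (-ξ)) := by
  have hF : MemLp (fun ξ => conj (𝓕 F (-ξ))) 2 :=
    ((Lp.memLp (𝓕 F)).comp_measurePreserving (Measure.measurePreserving_neg volume)).star
  refine ae_eq_of_integral_schwartz_mul_eq ((Lp.memLp _).locallyIntegrable one_le_two)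
    (hF.locallyIntegrable one_le_two) fun θ => ?_
  calc ∫ ξ, θ ξ * 𝓕 G ξ
      = ∫ x, 𝓕 (θ : ℝ → ℂ) x * conj (F x) := by
        rw [integral_mul_fourier]
        exact integral_congr_ae (h.mono fun x hx => by simp only [hx])
    _ = conj (∫ x, 𝓕 (conjNeg θ : ℝ → ℂ) x * F x) := by
        rw [← integral_conj]
        simp only [fourier_conjNeg, map_mul, Complex.conj_conj]
    _ = ∫ ξ, θ ξ * conj (𝓕 F (-ξ)) := by
        rw [← integral_mul_fourier, ← integral_conj, ← integral_neg_eq_self]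
        simp only [conjNeg_apply, map_mul, Complex.conj_conj, neg_neg]

theorem fourierInv_conj_ae {F G : Lp ℂ 2 (volume : Measure ℝ)}
    (h : ∀ᵐ ξ, G ξ = conj (F (-ξ))) : ∀ᵐ x, 𝓕⁻ G x = conj (𝓕⁻ F x) := by
  let F' := Complex.conjCLE.toContinuousLinearMap.compLp (𝓕⁻ F)
  have hF' : ∀ᵐ x, F' x = conj (𝓕⁻ F x) := ContinuousLinearMap.coeFn_compLp _ _
  have hFF' := fourier_conj_ae hF'
  rw [FourierTransform.fourier_fourierInv_eq] at hFF'
  have hG : 𝓕 F' = G := Lp.ext (by filter_upwards [h, hFF'] with ξ h₁ h₂ using h₂.trans h₁.symm)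
  rw [← hG, FourierTransform.fourierInv_fourier_eq]
  exact hF'

theorem hat_neg_ae (f : L2) : ∀ᵐ ξ, hat f (-ξ) = conj (hat f ξ) := by
  have hreal : ∀ᵐ x, Complex.ofRealCLM.compLp f x = conj (Complex.ofRealCLM.compLp f x) := by
    filter_upwards [Complex.ofRealCLM.coeFn_compLp f] with x hx
    simp [hx]
  filter_upwards [fourier_conj_ae hreal] with ξ hξ
  rw [hat, hξ, Complex.conj_conj]

theorem hat_sub (f g : L2) : hat (f - g) = hat f - hat g := by
  have h : Complex.ofRealCLM.compLp (f - g)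
      = Complex.ofRealCLM.compLp f - Complex.ofRealCLM.compLp g :=
    map_sub (Complex.ofRealCLM.compLpL 2 (volume : Measure ℝ)) f g
  rw [hat, h]
  exact map_sub (Lp.fourierTransformₗᵢ ℝ ℂ) _ _

theorem hat_multiplier {m : ℝ → ℂ} (hm : ∀ ξ, m (-ξ) = conj (m ξ)) {f : L2}
    (h : InDomain m f) : ∀ᵐ ξ, hat (multiplier m f) ξ = m (2 * Real.pi * ξ) * hat f ξ := by
  set F : Lp ℂ 2 (volume : Measure ℝ) := h.toLp _
  have hF : ∀ᵐ ξ, F ξ = m (2 * Real.pi * ξ) * hat f ξ := h.coeFn_toLp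
  have hneg : ∀ᵐ ξ, F (-ξ) = m (2 * Real.pi * -ξ) * hat f (-ξ) :=
    (Measure.measurePreserving_neg volume).quasiMeasurePreserving.ae hF
  have hreal := fourierInv_conj_ae (F := F) (G := F) <| by
    filter_upwards [hF, hneg, hat_neg_ae f] with ξ h₁ h₂ h₃
    simp [h₁, h₂, h₃, hm]
  have hre : Complex.ofRealCLM.compLp (Complex.reCLM.compLp (𝓕⁻ F)) = 𝓕⁻ F := by
    refine Lp.ext ?_
    filter_upwards [hreal, Complex.ofRealCLM.coeFn_compLp (Complex.reCLM.compLp (𝓕⁻ F)),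
      Complex.reCLM.coeFn_compLp (𝓕⁻ F)] with x h₁ h₂ h₃
    rw [h₂, h₃]
    exact Complex.conj_eq_iff_re.1 h₁.symm
  rwa [multiplier, dif_pos h, hat, hre, FourierTransform.fourier_fourierInv_eq]

theorem integral_sq_eq_integral_hat (f : L2) : ∫ x, f x ^ 2 = ∫ ξ, ‖hat f ξ‖ ^ 2 := by
  have hnorm : ‖hat f‖ = ‖f‖ := by
    rw [hat, Lp.norm_fourier_eq, Lp.norm_def, Lp.norm_def]
    refine congrArg _ (eLpNorm_congr_norm_ae ?_)
    filter_upwards [Complex.ofRealCLM.coeFn_compLp f] with x hx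
    simp [hx]
  rw [← sq_lpNorm_two (Lp.memLp _), ← toReal_eLpNorm (Lp.aestronglyMeasurable _), ← Lp.norm_def,
    hnorm, Lp.norm_def, toReal_eLpNorm (Lp.aestronglyMeasurable _), sq_lpNorm_two (Lp.memLp _)]
  simp only [Real.norm_eq_abs, sq_abs]

/-! ### Integrable Fourier transforms -/

theorem integral_mul_fourierInv_eq {f g : ℝ → ℂ} (hf : Integrable f) (hg : Integrable g) :
    ∫ x, f x * 𝓕⁻ g x = ∫ ξ, 𝓕⁻ f ξ * g ξ := by
  have h := VectorFourier.integral_fourierIntegral_smul_eq_flip (L := -innerₗ ℝ)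
    (μ := (volume : Measure ℝ)) (ν := (volume : Measure ℝ)) Real.continuous_fourierChar
    (by exact continuous_inner.neg) hf hg
  have hflip : (-innerₗ ℝ).flip = -innerₗ ℝ := by
    ext; simp
  rw [hflip] at h
  exact h.symm

theorem continuous_fourierInv {G : ℝ → ℂ} (hG : Integrable G) : Continuous (𝓕⁻ G) :=
  VectorFourier.fourierIntegral_continuous Real.continuous_fourierChar
    (by exact continuous_inner.neg) hG

theorem norm_fourierInv_le (G : ℝ → ℂ) (x : ℝ) : ‖𝓕⁻ G x‖ ≤ ∫ ξ, ‖G ξ‖ :=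
  VectorFourier.norm_fourierIntegral_le_integral_norm Real.fourierChar volume (-innerₗ ℝ) G x

/-- The convolution of two complex-valued functions on the line. -/
def conv (f g : ℝ → ℂ) (ξ : ℝ) : ℂ := ∫ ζ, f ζ * g (ξ - ζ)

theorem integrable_conv {f g : ℝ → ℂ} (hf : Integrable f) (hg : Integrable g) :
    Integrable (conv f g) :=
  hf.integrable_convolution (ContinuousLinearMap.mul ℂ ℂ) hg

theorem fourierInv_conv {f g : ℝ → ℂ} (hf : Integrable f) (hg : Integrable g) (x : ℝ) :
    𝓕⁻ (conv f g) x = 𝓕⁻ f x * 𝓕⁻ g x := by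
  simp only [Real.fourierInv_eq_fourier_neg]
  exact Real.fourier_mul_convolution_eq hf hg (-x)

/-- `G` is an integrable function whose inverse Fourier integral is `h`; such a pair can be
multiplied and tested against Schwartz functions without leaving classical integrals. -/
def HasFourier (h : ℝ → ℝ) (G : ℝ → ℂ) : Prop :=
  Integrable G ∧ ∀ᵐ x, (h x : ℂ) = 𝓕⁻ G x

theorem hasFourier_hat {f : L2} (hf : Integrable (hat f)) : HasFourier f (hat f) := by
  have hae : Complex.ofRealCLM.compLp f =ᵐ[volume] 𝓕⁻ (hat f : ℝ → ℂ) :=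
    ae_eq_of_integral_schwartz_mul_eq ((Lp.memLp _).locallyIntegrable one_le_two)
      (continuous_fourierInv hf).locallyIntegrable fun θ => by
        have h := integral_mul_fourier (Complex.ofRealCLM.compLp f) (𝓕⁻ θ)
        rw [← SchwartzMap.fourier_coe, FourierTransform.fourier_fourierInv_eq,
          SchwartzMap.fourierInv_coe] at h
        exact h.symm.trans (integral_mul_fourierInv_eq θ.integrable hf).symm
  refine ⟨hf, ?_⟩
  filter_upwards [hae, Complex.ofRealCLM.coeFn_compLp f] with x h₁ h₂
  rw [← h₁, h₂, Complex.ofRealCLM_apply]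

theorem HasFourier.mul {h k : ℝ → ℝ} {G K : ℝ → ℂ} (hh : HasFourier h G) (hk : HasFourier k K) :
    HasFourier (h * k) (conv G K) := by
  refine ⟨integrable_conv hh.1 hk.1, ?_⟩
  filter_upwards [hh.2, hk.2] with x h₁ h₂
  rw [fourierInv_conv hh.1 hk.1, ← h₁, ← h₂, Pi.mul_apply, Complex.ofReal_mul]

theorem HasFourier.integral_fourier {h : ℝ → ℝ} {G : ℝ → ℂ} (hh : HasFourier h G)
    (θ : 𝓢(ℝ, ℂ)) :
    ((∫ x, h x * (𝓕 θ x).re : ℝ) : ℂ) + Complex.I * ((∫ x, h x * (𝓕 θ x).im : ℝ) : ℂ)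
      = ∫ ξ, G ξ * θ ξ := by
  have hint : Integrable (fun x => 𝓕 θ x * 𝓕⁻ G x) :=
    (𝓕 θ).integrable.mul_bdd (c := ∫ ξ, ‖G ξ‖) (continuous_fourierInv hh.1).aestronglyMeasurable
      (ae_of_all _ (norm_fourierInv_le G))
  have hre : ∫ x, h x * (𝓕 θ x).re = ∫ x, (𝓕 θ x * 𝓕⁻ G x).re :=
    integral_congr_ae (hh.2.mono fun x hx => by
      simp only [← hx, Complex.re_mul_ofReal, mul_comm (h x)])
  have him : ∫ x, h x * (𝓕 θ x).im = ∫ x, (𝓕 θ x * 𝓕⁻ G x).im :=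
    integral_congr_ae (hh.2.mono fun x hx => by
      simp only [← hx, Complex.im_mul_ofReal, mul_comm (h x)])
  calc _ = ∫ x, 𝓕 θ x * 𝓕⁻ G x := by
        rw [hre, him, mul_comm Complex.I]
        exact integral_re_add_im hint
    _ = ∫ ξ, 𝓕⁻ (𝓕 θ) ξ * G ξ := by
        rw [integral_mul_fourierInv_eq (𝓕 θ).integrable hh.1, SchwartzMap.fourierInv_coe]
    _ = ∫ ξ, G ξ * θ ξ := by
        simp only [FourierTransform.fourierInv_fourier_eq, mul_comm]

/-! ### The equation on the Fourier side -/

/-- The angular frequency `k = 2πξ`, the symbol of `D` in Mathlib's normalization of `𝓕`.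
Fourier multipliers are written as pointwise scalar multiplications such as `freq • g`. -/
def freq (ξ : ℝ) : ℝ := 2 * Real.pi * ξ

/-- The symbol `1 + γ₁ k² + δ₁ k⁴` of the elliptic operator in front of `∂ₜη`. -/
def symb (γ₁ δ₁ ξ : ℝ) : ℝ := 1 + γ₁ * freq ξ ^ 2 + δ₁ * freq ξ ^ 4

/-- The quadratic nonlinearity on the Fourier side, up to the factor `-i k`. -/
def quadPart (γ : ℝ) (g : ℝ → ℂ) (ξ : ℝ) : ℂ :=
  ((3 / 4 - γ * freq ξ ^ 2 : ℝ) : ℂ) * conv g g ξ + 7 / 48 * conv (freq • g) (freq • g) ξ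

/-- The nonlinearity of the equation on the Fourier side, up to the factor `-i k`. -/
def nonlin (γ : ℝ) (g : ℝ → ℂ) (ξ : ℝ) : ℂ :=
  quadPart γ g ξ - 1 / 8 * conv g (conv g g) ξ

/-- The equation on the Fourier side reads `symb γ₁ δ₁ • ∂ₜg = rhs γ γ₂ δ₂ g`. -/
def rhs (γ γ₂ δ₂ : ℝ) (g : ℝ → ℂ) (ξ : ℝ) : ℂ :=
  -Complex.I * freq ξ *
    (((1 - γ₂ * freq ξ ^ 2 + δ₂ * freq ξ ^ 4 : ℝ) : ℂ) * g ξ + nonlin γ g ξ)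

/-- Multiplication of a Schwartz function by `(-i k)ⁿ`, which corresponds to `n` derivatives of
its Fourier transform. -/
def freqPow (n : ℕ) : 𝓢(ℝ, ℂ) →L[ℂ] 𝓢(ℝ, ℂ) :=
  SchwartzMap.smulLeftCLM ℂ fun ξ : ℝ => (-Complex.I * freq ξ) ^ n

theorem freqPow_apply (n : ℕ) (θ : 𝓢(ℝ, ℂ)) (ξ : ℝ) :
    freqPow n θ ξ = (-Complex.I * freq ξ) ^ n * θ ξ :=
  SchwartzMap.smulLeftCLM_apply_apply (by unfold freq; fun_prop) θ ξ

theorem iteratedDeriv_fourier (n : ℕ) (θ : 𝓢(ℝ, ℂ)) (x : ℝ) :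
    iteratedDeriv n (𝓕 θ : 𝓢(ℝ, ℂ)) x = 𝓕 (freqPow n θ) x := by
  have hint : ∀ m : ℕ, Integrable fun y : ℝ => y ^ m • θ y := fun m => by
    have h := (SchwartzMap.smulLeftCLM ℂ fun y : ℝ => y ^ m) θ |>.integrable (μ := volume)
    rwa [SchwartzMap.smulLeftCLM_apply (by fun_prop)] at h
  rw [SchwartzMap.fourier_coe, SchwartzMap.fourier_coe,
    Real.iteratedDeriv_fourier (N := ⊤) (fun m _ => hint m) le_top]
  refine congrFun (congrArg _ (funext fun ξ => ?_)) x
  simp only [freqPow_apply, freq, smul_eq_mul]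
  push_cast
  ring

theorem iteratedDeriv_postcompCLM (L : ℂ →L[ℝ] ℝ) (φ : 𝓢(ℝ, ℂ)) (n : ℕ) (x : ℝ) :
    iteratedDeriv n (SchwartzMap.postcompCLM L φ : 𝓢(ℝ, ℝ)) x = L (iteratedDeriv n φ x) := by
  change iteratedDeriv n (L ∘ φ) x = _
  rw [iteratedDeriv_eq_iteratedFDeriv, iteratedDeriv_eq_iteratedFDeriv,
    L.iteratedFDeriv_comp_left (φ.smooth n).contDiffAt le_rfl]
  rfl

/-- The test function for `∂ₜη`: multiplication of `θ` by `1 + γ₁ k² + δ₁ k⁴`. -/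
def ellipticTest (γ₁ δ₁ : ℝ) (θ : 𝓢(ℝ, ℂ)) : 𝓢(ℝ, ℂ) :=
  θ - γ₁ • freqPow 2 θ + δ₁ • freqPow 4 θ

/-- The test function for the linear terms: multiplication of `θ` by
`-i k (1 - γ₂ k² + δ₂ k⁴)`. -/
def dispersiveTest (γ₂ δ₂ : ℝ) (θ : 𝓢(ℝ, ℂ)) : 𝓢(ℝ, ℂ) :=
  freqPow 1 θ + γ₂ • freqPow 3 θ + δ₂ • freqPow 5 θ

theorem ellipticTest_apply (γ₁ δ₁ : ℝ) (θ : 𝓢(ℝ, ℂ)) (ξ : ℝ) :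
    ellipticTest γ₁ δ₁ θ ξ = symb γ₁ δ₁ ξ * θ ξ := by
  simp only [ellipticTest, freqPow_apply, symb, add_apply, sub_apply,
    smul_apply, Complex.real_smul]
  push_cast
  linear_combination (-γ₁ * freq ξ ^ 2 + δ₁ * freq ξ ^ 4 * (Complex.I ^ 2 - 1)) * θ ξ
    * Complex.I_sq

theorem dispersiveTest_apply (γ₂ δ₂ : ℝ) (θ : 𝓢(ℝ, ℂ)) (ξ : ℝ) :
    dispersiveTest γ₂ δ₂ θ ξ
      = -Complex.I * freq ξ * (1 - γ₂ * freq ξ ^ 2 + δ₂ * freq ξ ^ 4) * θ ξ := by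
  simp only [dispersiveTest, freqPow_apply, add_apply, smul_apply,
    Complex.real_smul]
  linear_combination (-γ₂ * freq ξ ^ 3 - δ₂ * freq ξ ^ 5 * (Complex.I ^ 2 - 1)) * Complex.I * θ ξ
    * Complex.I_sq

theorem fourier_ellipticTest (γ₁ δ₁ : ℝ) (θ : 𝓢(ℝ, ℂ)) (x : ℝ) :
    𝓕 (ellipticTest γ₁ δ₁ θ) x = 𝓕 θ x - γ₁ * iteratedDeriv 2 (𝓕 θ : 𝓢(ℝ, ℂ)) x
      + δ₁ * iteratedDeriv 4 (𝓕 θ : 𝓢(ℝ, ℂ)) x := by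
  simp [iteratedDeriv_fourier, ellipticTest, sub_eq_add_neg, FourierTransform.fourier_add,
    FourierTransform.fourier_smul, FourierTransform.fourier_neg]

theorem fourier_dispersiveTest (γ₂ δ₂ : ℝ) (θ : 𝓢(ℝ, ℂ)) (x : ℝ) :
    𝓕 (dispersiveTest γ₂ δ₂ θ) x = iteratedDeriv 1 (𝓕 θ : 𝓢(ℝ, ℂ)) x
      + γ₂ * iteratedDeriv 3 (𝓕 θ : 𝓢(ℝ, ℂ)) x + δ₂ * iteratedDeriv 5 (𝓕 θ : 𝓢(ℝ, ℂ)) x := by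
  simp [iteratedDeriv_fourier, dispersiveTest, FourierTransform.fourier_add,
    FourierTransform.fourier_smul]

theorem IsSolution.hasDerivWithinAt_clm {γ γ₁ γ₂ δ₁ δ₂ T : ℝ} {η₀ : L2} {η : ℝ → L2}
    (hsol : IsSolution γ γ₁ γ₂ δ₁ δ₂ T η₀ η) (L : ℂ →L[ℝ] ℝ) (θ : 𝓢(ℝ, ℂ)) {t : ℝ}
    (ht : t ∈ Icc 0 T) :
    HasDerivWithinAt (fun r => ∫ x, η r x * L (𝓕 (ellipticTest γ₁ δ₁ θ) x))
      ((∫ x, η t x * L (𝓕 (dispersiveTest γ₂ δ₂ θ) x))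
        + (3 / 4) * (∫ x, η t x ^ 2 * L (𝓕 (freqPow 1 θ) x))
        + γ * (∫ x, η t x ^ 2 * L (𝓕 (freqPow 3 θ) x))
        - (7 / 48) * (∫ x, dx (η t) x ^ 2 * L (𝓕 (freqPow 1 θ) x))
        - (1 / 8) * (∫ x, η t x ^ 3 * L (𝓕 (freqPow 1 θ) x))) (Icc 0 T) t := by
  have hL : ∀ (c : ℝ) (z : ℂ), L (c * z) = c * L z := fun c z => by
    rw [← Complex.real_smul, map_smul, smul_eq_mul]
  have h := hsol.equation (SchwartzMap.postcompCLM L (𝓕 θ)) t ht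
  simp only [← iteratedDeriv_one, iteratedDeriv_postcompCLM, SchwartzMap.postcompCLM_apply] at h
  simp only [fourier_ellipticTest, fourier_dispersiveTest, map_add, map_sub, hL,
    ← iteratedDeriv_fourier]
  exact h

theorem integrable_mul_schwartz {G : ℝ → ℂ} (hG : Integrable G) (θ : 𝓢(ℝ, ℂ)) :
    Integrable fun ξ => G ξ * θ ξ :=
  hG.mul_bdd (c := SchwartzMap.seminorm ℝ 0 0 θ) θ.continuous.aestronglyMeasurable
    (ae_of_all _ (θ.norm_le_seminorm ℝ))

theorem integral_rhs_mul (γ γ₂ δ₂ : ℝ) {g : ℝ → ℂ} (hg : Integrable g)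
    (hkg : Integrable (freq • g)) (θ : 𝓢(ℝ, ℂ)) :
    ∫ ξ, rhs γ γ₂ δ₂ g ξ * θ ξ = (∫ ξ, g ξ * dispersiveTest γ₂ δ₂ θ ξ)
      + (3 / 4) * (∫ ξ, conv g g ξ * freqPow 1 θ ξ)
      + γ * (∫ ξ, conv g g ξ * freqPow 3 θ ξ)
      + (7 / 48) * (∫ ξ, conv (freq • g) (freq • g) ξ * freqPow 1 θ ξ)
      - (1 / 8) * (∫ ξ, conv g (conv g g) ξ * freqPow 1 θ ξ) := by
  have hgg := integrable_conv hg hg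
  have h₁ := integrable_mul_schwartz hg (dispersiveTest γ₂ δ₂ θ)
  have h₂ := (integrable_mul_schwartz hgg (freqPow 1 θ)).const_mul (3 / 4)
  have h₃ := (integrable_mul_schwartz hgg (freqPow 3 θ)).const_mul (γ : ℂ)
  have h₄ := (integrable_mul_schwartz (integrable_conv hkg hkg) (freqPow 1 θ)).const_mul (7 / 48)
  have h₅ := (integrable_mul_schwartz (integrable_conv hg hgg) (freqPow 1 θ)).const_mul (1 / 8)
  simp only [← integral_const_mul]
  rw [← integral_add h₁ h₂, ← integral_add ?_ h₃, ← integral_add ?_ h₄, ← integral_sub ?_ h₅]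
  · refine integral_congr_ae (ae_of_all _ fun ξ => ?_)
    simp only [rhs, nonlin, quadPart, freqPow_apply, dispersiveTest_apply]
    push_cast
    linear_combination γ * conv g g ξ * Complex.I * freq ξ ^ 3 * θ ξ * Complex.I_sq
  · exact ((h₁.add h₂).add h₃).add h₄
  · exact (h₁.add h₂).add h₃
  · exact h₁.add h₂

theorem conv_const_mul (c d : ℂ) (f g : ℝ → ℂ) (ξ : ℝ) :
    conv (fun ζ => c * f ζ) (fun ζ => d * g ζ) ξ = c * d * conv f g ξ := by
  simp only [conv, ← integral_const_mul]
  exact integral_congr_ae (ae_of_all _ fun ζ => by ring)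

theorem IsSolution.hasDerivWithinAt_hat {γ γ₁ γ₂ δ₁ δ₂ T : ℝ} {η₀ : L2} {η : ℝ → L2}
    (hsol : IsSolution γ γ₁ γ₂ δ₁ δ₂ T η₀ η)
    (hη : ∀ t ∈ Icc 0 T, HasFourier (η t) (hat (η t))) {t : ℝ} (ht : t ∈ Icc 0 T)
    (hk : Integrable (freq • (hat (η t) : ℝ → ℂ)))
    (hdx : HasFourier (dx (η t)) (fun ξ => Complex.I * (freq • (hat (η t) : ℝ → ℂ)) ξ))
    (θ : 𝓢(ℝ, ℂ)) :
    HasDerivWithinAt (fun r => ∫ ξ, hat (η r) ξ * (symb γ₁ δ₁ ξ * θ ξ))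
      (∫ ξ, rhs γ γ₂ δ₂ (hat (η t)) ξ * θ ξ) (Icc 0 T) t := by
  have hre := hsol.hasDerivWithinAt_clm Complex.reCLM θ ht
  have him := hsol.hasDerivWithinAt_clm Complex.imCLM θ ht
  have hsq := (hη t ht).mul (hη t ht)
  have hcube := (hη t ht).mul hsq
  have hdxsq := hdx.mul hdx
  refine ((hre.ofReal_comp.add (him.ofReal_comp.const_mul Complex.I)).congr_of_mem
    (fun r hr => ?_) ht).congr_deriv ?_
  · simp only [← ellipticTest_apply]
    exact ((hη r hr).integral_fourier (ellipticTest γ₁ δ₁ θ)).symm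
  · set G : ℝ → ℂ := ⇑(hat (η t))
    have hconv : conv (fun ξ => Complex.I * (freq • G) ξ) (fun ξ => Complex.I * (freq • G) ξ)
        = fun ξ => -conv (freq • G) (freq • G) ξ := funext fun ξ => by
      rw [conv_const_mul, Complex.I_mul_I, neg_one_mul]
    have e₁ := (hη t ht).integral_fourier (dispersiveTest γ₂ δ₂ θ)
    have e₂ := hsq.integral_fourier (freqPow 1 θ)
    have e₃ := hsq.integral_fourier (freqPow 3 θ)
    have e₄ := hdxsq.integral_fourier (freqPow 1 θ)
    have e₅ := hcube.integral_fourier (freqPow 1 θ)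
    simp only [hconv, neg_mul, integral_neg, ← pow_two, ← pow_succ', Nat.reduceAdd,
      Pi.pow_apply] at e₂ e₃ e₄ e₅
    rw [integral_rhs_mul _ _ _ (hη t ht).1 hk, ← e₁, ← e₂, ← e₃, ← e₅,
      ← neg_eq_iff_eq_neg.2 e₄]
    simp only [Complex.reCLM_apply, Complex.imCLM_apply]
    push_cast
    ring

/-! ### From weak to strong derivatives in a Hilbert space -/

theorem hasDerivWithinAt_of_inner {X : Type*} [NormedAddCommGroup X] [InnerProductSpace ℂ X]
    [CompleteSpace X] {D : Set X} (hD : Dense D) {u v : ℝ → X} {T : ℝ}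
    (hv : ContinuousOn v (Icc 0 T))
    (huv : ∀ d ∈ D, ∀ t ∈ Icc 0 T,
      HasDerivWithinAt (fun r => inner ℂ d (u r)) (inner ℂ d (v t)) (Icc 0 T) t)
    {t : ℝ} (ht : t ∈ Icc 0 T) : HasDerivWithinAt u (v t) (Icc 0 T) t := by
  let _ : InnerProductSpace ℝ X := InnerProductSpace.rclikeToReal ℂ X
  have hT : 0 ≤ T := ht.1.trans ht.2
  set w : ℝ → X := IccExtend hT ((Icc 0 T).domRestrict v)
  have hwc : Continuous w := (continuousOn_iff_continuous_domRestrict.1 hv).Icc_extend'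
  have hwv : ∀ r ∈ Icc 0 T, w r = v r := fun r hr => IccExtend_of_mem hT _ hr
  have hV : ∀ r, HasDerivAt (fun r => ∫ s in (0 : ℝ)..r, w s) (w r) r := fun r =>
    (hwc.integral_hasStrictDerivAt 0 r).hasDerivAt
  have hconst : ∀ r ∈ Icc 0 T, u r - ∫ s in (0 : ℝ)..r, w s = u 0 := by
    intro r hr
    refine hD.eq_of_inner_right ℂ fun d hd => ?_
    have hderiv : ∀ s ∈ Icc 0 T, HasDerivWithinAt
        (fun r => inner ℂ d (u r - ∫ s in (0 : ℝ)..r, w s)) 0 (Icc 0 T) s := fun s hs => by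
      have h := (((innerSL ℂ d).restrictScalars ℝ).hasFDerivAt.comp_hasDerivAt s (hV s))
      refine ((huv d hd s hs).sub h.hasDerivWithinAt).congr_deriv ?_ |>.congr_of_mem
        (fun r _ => inner_sub_right _ _ _) hs
      simp [hwv s hs]
    have h := (convex_Icc 0 T).norm_image_sub_le_of_norm_hasDerivWithin_le (C := 0) hderiv
      (by simp) ⟨le_rfl, hT⟩ hr
    rw [zero_mul, norm_le_zero_iff, sub_eq_zero] at h
    simpa only [intervalIntegral.integral_same, sub_zero] using h
  refine ((hV t).hasDerivWithinAt.const_add (u 0)).congr_of_mem (fun r hr => ?_) ht |>.congr_deriv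
    (hwv t ht)
  rw [← hconst r hr, sub_add_cancel]

/-! ### Convolutions of square-integrable functions -/

theorem integral_norm_mul_norm_le {α E F : Type*} [MeasurableSpace α] {μ : Measure α}
    [NormedAddCommGroup E] [NormedAddCommGroup F] {f : α → E} {g : α → F} (hf : MemLp f 2 μ)
    (hg : MemLp g 2 μ) : ∫ x, ‖f x‖ * ‖g x‖ ∂μ ≤ lpNorm f 2 μ * lpNorm g 2 μ := by
  have h := integral_mul_norm_le_Lp_mul_Lq (μ := μ) (f := (‖f ·‖)) (g := (‖g ·‖))
    Real.HolderConjugate.two_two (by simpa using hf.norm) (by simpa using hg.norm)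
  simpa only [norm_norm, Real.rpow_two, ← sq_lpNorm_two hf, ← sq_lpNorm_two hg, ← Real.sqrt_eq_rpow,
    Real.sqrt_sq lpNorm_nonneg] using h

theorem lpNorm_le_of_norm_le {α E F : Type*} [MeasurableSpace α] {μ : Measure α}
    [NormedAddCommGroup E] [NormedAddCommGroup F] {p : ENNReal} {f : α → E} {g : α → F}
    (hg : MemLp g p μ) (h : ∀ x, ‖f x‖ ≤ ‖g x‖) : lpNorm f p μ ≤ lpNorm g p μ :=
  (lpNorm_mono_real hg.norm h).trans_eq (lpNorm_norm hg.1 p)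

theorem memLp_comp_sub_left {g : ℝ → ℂ} (hg : MemLp g 2) (ξ : ℝ) :
    MemLp (fun ζ => g (ξ - ζ)) 2 :=
  hg.comp_measurePreserving (Measure.measurePreserving_sub_left volume ξ)

theorem lpNorm_comp_sub_left {g : ℝ → ℂ} (hg : MemLp g 2) (ξ : ℝ) :
    ‖fun ζ => g (ξ - ζ)‖₂ = ‖g‖₂ := by
  rw [← toReal_eLpNorm (memLp_comp_sub_left hg ξ).1, ← toReal_eLpNorm hg.1]
  exact congrArg _
    (eLpNorm_comp_measurePreserving hg.1 (Measure.measurePreserving_sub_left volume ξ))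

theorem integrable_conv_integrand {f g : ℝ → ℂ} (hf : MemLp f 2) (hg : MemLp g 2) (ξ : ℝ) :
    Integrable fun ζ => f ζ * g (ξ - ζ) :=
  hf.integrable_mul (memLp_comp_sub_left hg ξ)

theorem integral_norm_conv_integrand_le {f g : ℝ → ℂ} (hf : MemLp f 2) (hg : MemLp g 2) (ξ : ℝ) :
    ∫ ζ, ‖f ζ * g (ξ - ζ)‖ ≤ ‖f‖₂ * ‖g‖₂ := by
  simpa only [norm_mul, lpNorm_comp_sub_left hg] using
    integral_norm_mul_norm_le hf (memLp_comp_sub_left hg ξ)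

theorem norm_conv_le {f g : ℝ → ℂ} (hf : MemLp f 2) (hg : MemLp g 2) (ξ : ℝ) :
    ‖conv f g ξ‖ ≤ ‖f‖₂ * ‖g‖₂ :=
  (norm_integral_le_integral_norm _).trans (integral_norm_conv_integrand_le hf hg ξ)

theorem norm_conv_le_of_bounded {f g : ℝ → ℂ} {B : ℝ} (hf : Integrable f)
    (hg : ∀ ξ, ‖g ξ‖ ≤ B) (ξ : ℝ) : ‖conv f g ξ‖ ≤ (∫ ζ, ‖f ζ‖) * B := by
  rw [← integral_mul_const]
  refine norm_integral_le_of_norm_le (hf.norm.mul_const B) (ae_of_all _ fun ζ => ?_)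
  rw [norm_mul]
  gcongr
  exact hg _

theorem norm_conv_conv_le {f g h : ℝ → ℂ} (hf : Integrable f) (hg : MemLp g 2)
    (hh : MemLp h 2) (ξ : ℝ) : ‖conv f (conv g h) ξ‖ ≤ (∫ ζ, ‖f ζ‖) * (‖g‖₂ * ‖h‖₂) :=
  norm_conv_le_of_bounded hf (norm_conv_le hg hh) ξ

theorem aestronglyMeasurable_conv {f g : ℝ → ℂ} (hf : AEStronglyMeasurable f)
    (hg : AEStronglyMeasurable g) : AEStronglyMeasurable (conv f g) :=
  (hf.convolution_integrand (ContinuousLinearMap.mul ℂ ℂ) hg).integral_prod_right'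

theorem conv_comm (f g : ℝ → ℂ) : conv f g = conv g f := funext fun ξ => by
  rw [conv, conv, ← integral_sub_left_eq_self _ volume ξ]
  simp only [sub_sub_cancel, mul_comm]

theorem conv_add_right {f g h : ℝ → ℂ} (hf : MemLp f 2) (hg : MemLp g 2) (hh : MemLp h 2) :
    conv f (g + h) = conv f g + conv f h := funext fun ξ => by
  simp only [conv, Pi.add_apply, mul_add]
  exact integral_add (integrable_conv_integrand hf hg ξ) (integrable_conv_integrand hf hh ξ)

theorem memLp_two_of_integrable_of_bounded {α E : Type*} [MeasurableSpace α] {μ : Measure α}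
    [NormedAddCommGroup E] {f : α → E} {B : ℝ} (hf : Integrable f μ) (hB : ∀ x, ‖f x‖ ≤ B) :
    MemLp f 2 μ := by
  rw [memLp_two_iff_integrable_sq_norm hf.1]
  refine (hf.norm.const_mul B).mono' (hf.1.norm.pow 2) (ae_of_all _ fun x => ?_)
  rw [Real.norm_of_nonneg (by positivity), sq]
  gcongr
  exact hB x

theorem memLp_conv {f g : ℝ → ℂ} (hf : Integrable f) (hg : Integrable g) (hf2 : MemLp f 2)
    (hg2 : MemLp g 2) : MemLp (conv f g) 2 :=
  memLp_two_of_integrable_of_bounded (integrable_conv hf hg) (norm_conv_le hf2 hg2)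

theorem freq_smul_conv {f g : ℝ → ℂ} (hf : MemLp f 2) (hg : MemLp g 2)
    (hkf : MemLp (freq • f) 2) (hkg : MemLp (freq • g) 2) :
    freq • conv f g = conv (freq • f) g + conv f (freq • g) := funext fun ξ => by
  rw [Pi.smul_apply', Pi.add_apply, conv, conv, conv, ← integral_smul,
    ← integral_add (integrable_conv_integrand hkf hg ξ) (integrable_conv_integrand hf hkg ξ)]
  refine integral_congr_ae (ae_of_all _ fun ζ => ?_)
  simp only [Pi.smul_apply', Complex.real_smul, freq]
  push_cast
  ring

theorem freq_smul_conv_self {f : ℝ → ℂ} (hf : MemLp f 2) (hkf : MemLp (freq • f) 2) :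
    freq • conv f f = (2 : ℂ) • conv f (freq • f) := by
  rw [freq_smul_conv hf hf hkf hkf, conv_comm (freq • f) f, two_smul]

/-! ### Trilinear forms -/

/-- The integrand of the trilinear form `triple`. -/
def tripleKernel (f g h : ℝ → ℂ) (p : ℝ × ℝ) : ℂ := f p.1 * g p.2 * h (-p.1 - p.2)

/-- The symmetric trilinear form `∬ f(x) g(y) h(-x-y) dx dy`, which is the integral of
`h(-ξ) (f ∗ g)(ξ)`. -/
def triple (f g h : ℝ → ℂ) : ℂ := ∫ p, tripleKernel f g h p

section triple

variable {f g h : ℝ → ℂ}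

theorem measurePreserving_fst_neg_sub :
    MeasurePreserving (fun p : ℝ × ℝ => (p.1, -p.1 - p.2)) :=
  (MeasurePreserving.id volume).skew_product (g := fun x y => -x - y) (by fun_prop)
    (ae_of_all _ fun x => (Measure.measurePreserving_sub_left volume (-x)).map_eq)

theorem measurePreserving_fst_sub :
    MeasurePreserving (fun p : ℝ × ℝ => (p.1, p.2 - p.1)) :=
  (MeasurePreserving.id volume).skew_product (g := fun x y => y - x) (by fun_prop)
    (ae_of_all _ fun x => (measurePreserving_sub_right volume x).map_eq)

theorem integral_comp_of_measurePreserving {α E : Type*} [MeasurableSpace α] {μ : Measure α}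
    [NormedAddCommGroup E] [NormedSpace ℝ E] {φ : α → α} {F : α → E}
    (hφ : MeasurePreserving φ μ μ) (hF : AEStronglyMeasurable F μ) :
    ∫ x, F (φ x) ∂μ = ∫ x, F x ∂μ := by
  conv_rhs => rw [← hφ.map_eq]
  exact (integral_map hφ.aemeasurable (by rwa [hφ.map_eq])).symm

theorem tripleKernel_fst_neg_sub (p : ℝ × ℝ) :
    tripleKernel f g h (p.1, -p.1 - p.2) = tripleKernel f h g p := by
  simp only [tripleKernel, sub_sub_cancel, mul_right_comm]

theorem tripleKernel_swap (p : ℝ × ℝ) :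
    tripleKernel f g h p.swap = tripleKernel g f h p := by
  simp only [tripleKernel, Prod.fst_swap, Prod.snd_swap, neg_sub_comm, mul_comm (f _)]

theorem tripleKernel_fst_sub (p : ℝ × ℝ) :
    tripleKernel f g h (p.1, p.2 - p.1) = h (-p.2) * (f p.1 * g (p.2 - p.1)) := by
  rw [tripleKernel, mul_comm]
  congr 2
  ring

theorem integrable_tripleKernel_comm_left (hi : Integrable (tripleKernel f g h)) :
    Integrable (tripleKernel g f h) :=
  (Measure.measurePreserving_swap.integrable_comp_of_integrable hi).congr
    (ae_of_all _ tripleKernel_swap)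

theorem triple_comm_right (hi : Integrable (tripleKernel f g h)) : triple f h g = triple f g h := by
  simp only [triple, ← tripleKernel_fst_neg_sub (f := f) (g := g) (h := h)]
  exact integral_comp_of_measurePreserving measurePreserving_fst_neg_sub hi.1

variable (f g h) in
theorem triple_comm_left : triple g f h = triple f g h := by
  simp only [triple, ← tripleKernel_swap (f := f) (g := g) (h := h)]
  exact integral_prod_swap (tripleKernel f g h)

theorem aestronglyMeasurable_tripleKernel (hf : AEStronglyMeasurable f)
    (hg : AEStronglyMeasurable g) (hh : AEStronglyMeasurable h) :
    AEStronglyMeasurable (tripleKernel f g h) :=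
  (hf.comp_fst.mul hg.comp_snd).mul
    (hh.comp_snd.comp_quasiMeasurePreserving measurePreserving_fst_neg_sub.quasiMeasurePreserving)

theorem integral_norm_tripleKernel_slice_le (hg : MemLp g 2) (hh : MemLp h 2) (x : ℝ) :
    ∫ y, ‖tripleKernel f g h (x, y)‖ ≤ ‖f x‖ * (‖g‖₂ * ‖h‖₂) := by
  simp only [tripleKernel, mul_assoc, norm_mul (f x), integral_const_mul]
  gcongr
  exact integral_norm_conv_integrand_le hg hh (-x)

theorem integrable_tripleKernel (hf : Integrable f) (hg : MemLp g 2) (hh : MemLp h 2) :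
    Integrable (tripleKernel f g h) := by
  have hm := aestronglyMeasurable_tripleKernel hf.1 hg.1 hh.1
  refine (integrable_prod_iff hm).2 ⟨ae_of_all _ fun x => ?_, ?_⟩
  · simpa only [tripleKernel, mul_assoc] using
      (integrable_conv_integrand hg hh (-x)).const_mul (f x)
  · refine (hf.norm.mul_const (‖g‖₂ * ‖h‖₂)).mono' hm.norm.integral_prod_right'
      (ae_of_all _ fun x => ?_)
    rw [Real.norm_of_nonneg (integral_nonneg fun y => norm_nonneg _)]
    exact integral_norm_tripleKernel_slice_le hg hh x

theorem integral_norm_tripleKernel_le (hf : Integrable f) (hg : MemLp g 2) (hh : MemLp h 2) :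
    ∫ p, ‖tripleKernel f g h p‖ ≤ (∫ x, ‖f x‖) * (‖g‖₂ * ‖h‖₂) := by
  have hi := (integrable_tripleKernel hf hg hh).norm
  rw [← integral_mul_const]
  exact (integral_prod _ hi).trans_le <| integral_mono hi.integral_prod_left (hf.norm.mul_const _)
    fun x => integral_norm_tripleKernel_slice_le hg hh x

theorem integrable_tripleKernel_fst_sub (hi : Integrable (tripleKernel f g h)) :
    Integrable (fun p : ℝ × ℝ => h (-p.2) * (f p.1 * g (p.2 - p.1))) (volume.prod volume) :=
  (measurePreserving_fst_sub.integrable_comp_of_integrable hi).congr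
    (ae_of_all _ tripleKernel_fst_sub)

theorem integrable_mul_conv (hi : Integrable (tripleKernel f g h)) :
    Integrable fun ξ => h (-ξ) * conv f g ξ := by
  simpa only [conv, ← integral_const_mul] using
    (integrable_tripleKernel_fst_sub hi).integral_prod_right

theorem integral_mul_conv (hi : Integrable (tripleKernel f g h)) :
    ∫ ξ, h (-ξ) * conv f g ξ = triple f g h := by
  simp only [conv, ← integral_const_mul]
  rw [triple, ← integral_comp_of_measurePreserving measurePreserving_fst_sub hi.1]
  simp only [tripleKernel_fst_sub]
  exact (integral_prod_symm _ (integrable_tripleKernel_fst_sub hi)).symm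

theorem integral_norm_mul_conv_le (hf : Integrable f) (hg : MemLp g 2) (hh : MemLp h 2) :
    ∫ ξ, ‖h (-ξ) * conv f g ξ‖ ≤ (∫ x, ‖f x‖) * (‖g‖₂ * ‖h‖₂) := by
  have hi := integrable_tripleKernel hf hg hh
  have hs := (integrable_tripleKernel_fst_sub hi).norm
  calc ∫ ξ, ‖h (-ξ) * conv f g ξ‖
      ≤ ∫ ξ, ∫ ζ, ‖h (-ξ) * (f ζ * g (ξ - ζ))‖ := by
        refine integral_mono (integrable_mul_conv hi).norm hs.integral_prod_right fun ξ => ?_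
        simp only [conv, ← integral_const_mul]
        exact norm_integral_le_integral_norm _
    _ = ∫ p, ‖tripleKernel f g h p‖ := by
        rw [← integral_comp_of_measurePreserving measurePreserving_fst_sub hi.1.norm]
        simp only [tripleKernel_fst_sub]
        exact (integral_prod_symm _ hs).symm
    _ ≤ _ := integral_norm_tripleKernel_le hf hg hh

-- The frequencies `x`, `y`, `-x-y` of the three factors add up to zero.
theorem triple_freq_smul (h₁ : Integrable (tripleKernel (freq • f) g h))
    (h₂ : Integrable (tripleKernel f (freq • g) h))
    (h₃ : Integrable (tripleKernel f g (freq • h))) :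
    triple (freq • f) g h + triple f (freq • g) h + triple f g (freq • h) = 0 := by
  rw [triple, triple, triple, ← integral_add' h₁ h₂, ← integral_add' (h₁.add h₂) h₃]
  refine integral_eq_zero_of_ae (ae_of_all _ fun p => ?_)
  simp only [tripleKernel, freq, Pi.add_apply, Pi.smul_apply', Pi.zero_apply, Complex.real_smul]
  push_cast
  ring

end triple

theorem triple_self_self_freq_smul {f : ℝ → ℂ} (hf : Integrable f) (hf2 : MemLp f 2)
    (hkf : MemLp (freq • f) 2) : triple f f (freq • f) = 0 := by
  have h₃ := integrable_tripleKernel hf hf2 hkf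
  have h₂ := integrable_tripleKernel hf hkf hf2
  have h := triple_freq_smul (integrable_tripleKernel_comm_left h₂) h₂ h₃
  rw [triple_comm_left f, triple_comm_right h₃] at h
  linear_combination h / 3

theorem two_mul_triple_freq_smul_freq_smul {f : ℝ → ℂ} (hf : Integrable f)
    (hkf : Integrable (freq • f)) (hkf2 : MemLp (freq • f) 2)
    (hkkf : MemLp (freq • freq • f) 2) :
    2 * triple f (freq • f) (freq • freq • f)
      = -triple (freq • f) (freq • f) (freq • f) := by
  have h₃ := integrable_tripleKernel hf hkf2 hkkf
  have h₂ := integrable_tripleKernel hf hkkf hkf2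
  have h := triple_freq_smul (integrable_tripleKernel hkf hkf2 hkf2) h₂ h₃
  rw [triple_comm_right h₃] at h
  linear_combination h

theorem triple_self_conv_freq_smul {f : ℝ → ℂ} (hf : Integrable f) (hf2 : MemLp f 2)
    (hkf : Integrable (freq • f)) (hkf2 : MemLp (freq • f) 2) :
    triple f (conv f f) (freq • f) = 0 := by
  have hff := memLp_conv hf hf hf2 hf2
  have hkff : MemLp (freq • conv f f) 2 := by
    rw [freq_smul_conv_self hf2 hkf2]
    exact (memLp_conv hf hkf hf2 hkf2).const_smul 2
  have h₁ := integrable_tripleKernel hkf hf2 hff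
  have h₂ := integrable_tripleKernel hf hkf2 hff
  have h₃ := integrable_tripleKernel hf hf2 hkff
  have hodd : triple f f (freq • conv f f) = 0 := by
    rw [← integral_mul_conv h₃]
    refine self_eq_neg.1 ?_
    conv_lhs => rw [← integral_neg_eq_self]
    rw [← integral_neg]
    refine integral_congr_ae (ae_of_all _ fun ξ => ?_)
    simp only [Pi.smul_apply', freq, Complex.real_smul, neg_neg]
    push_cast
    ring
  have h := triple_freq_smul h₁ h₂ h₃
  rw [hodd, triple_comm_left f] at h
  rw [triple_comm_right h₂]
  linear_combination h / 2

/-! ### Sobolev weights -/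

/-- The Japanese bracket `⟨k⟩ = (1 + k²)^{1/2}`. -/
def bracket (ξ : ℝ) : ℝ := √(1 + freq ξ ^ 2)

/-- Membership in the image of the Sobolev space `Hˢ` under the Fourier transform. -/
def MemSob (s : ℕ) (f : ℝ → ℂ) : Prop := MemLp (bracket ^ s • f) 2

/-- The norm of the Sobolev space `Hˢ`, as a function of the Fourier transform. -/
def sobNorm (s : ℕ) (f : ℝ → ℂ) : ℝ := ‖bracket ^ s • f‖₂

/-- The constant in the embedding of `H¹` into the functions with integrable Fourier transform. -/
def bracketConst : ℝ := ‖fun ξ => (bracket ξ)⁻¹‖₂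

theorem continuous_freq : Continuous freq := by unfold freq; fun_prop

theorem sq_bracket (ξ : ℝ) : bracket ξ ^ 2 = 1 + freq ξ ^ 2 := Real.sq_sqrt (by positivity)

theorem one_le_bracket (ξ : ℝ) : 1 ≤ bracket ξ :=
  Real.one_le_sqrt.2 (le_add_of_nonneg_right (sq_nonneg _))

theorem bracket_pos (ξ : ℝ) : 0 < bracket ξ := one_pos.trans_le (one_le_bracket ξ)

theorem abs_freq_le_bracket (ξ : ℝ) : |freq ξ| ≤ bracket ξ :=
  Real.abs_le_sqrt (le_add_of_nonneg_left zero_le_one)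

theorem continuous_bracket : Continuous bracket :=
  (continuous_const.add (continuous_freq.pow 2)).sqrt

theorem bracketConst_nonneg : 0 ≤ bracketConst := lpNorm_nonneg

theorem sobNorm_nonneg {s : ℕ} {f : ℝ → ℂ} : 0 ≤ sobNorm s f := lpNorm_nonneg

theorem memLp_inv_bracket : MemLp (fun ξ => (bracket ξ)⁻¹) 2 := by
  have hc : Continuous fun ξ => (bracket ξ)⁻¹ :=
    continuous_bracket.inv₀ fun ξ => (bracket_pos ξ).ne'
  rw [memLp_two_iff_integrable_sq hc.aestronglyMeasurable]
  simpa only [inv_pow, sq_bracket, freq] using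
    integrable_inv_one_add_sq.comp_mul_left' (R := 2 * Real.pi) (by positivity)

theorem norm_bracket_pow_smul (s : ℕ) (f : ℝ → ℂ) (ξ : ℝ) :
    ‖(bracket ^ s • f) ξ‖ = bracket ξ ^ s * ‖f ξ‖ := by
  rw [Pi.smul_apply', Pi.pow_apply, norm_smul, Real.norm_of_nonneg (pow_pos (bracket_pos ξ) s).le]

section MemSob

variable {s t : ℕ} {f g : ℝ → ℂ} {m : ℝ}

theorem memSob_zero : MemSob 0 f ↔ MemLp f 2 := by
  rw [MemSob, pow_zero, one_smul]

theorem sobNorm_zero : sobNorm 0 f = ‖f‖₂ := by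
  rw [sobNorm, pow_zero, one_smul]

theorem aestronglyMeasurable_of_smul {w : ℝ → ℝ} (hw : Continuous w) (hw0 : ∀ ξ, w ξ ≠ 0)
    (h : AEStronglyMeasurable (w • f)) : AEStronglyMeasurable f := by
  refine ((hw.inv₀ hw0).aestronglyMeasurable.smul h).congr (ae_of_all _ fun ξ => ?_)
  exact inv_smul_smul₀ (hw0 ξ) (f ξ)

theorem MemSob.aestronglyMeasurable (hf : MemSob s f) : AEStronglyMeasurable f :=
  aestronglyMeasurable_of_smul (continuous_bracket.pow s) (fun ξ => (pow_pos (bracket_pos ξ) s).ne')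
    hf.1

theorem MemSob.of_norm_le (hg : MemSob t g) (hf : AEStronglyMeasurable f)
    (h : ∀ ξ, bracket ξ ^ s * ‖f ξ‖ ≤ m * (bracket ξ ^ t * ‖g ξ‖)) : MemSob s f :=
  MemLp.of_le_mul hg ((continuous_bracket.pow s).aestronglyMeasurable.smul hf)
    (ae_of_all _ fun ξ => by simpa only [norm_bracket_pow_smul] using h ξ)

theorem sobNorm_le_of_norm_le (hg : MemSob t g)
    (h : ∀ ξ, bracket ξ ^ s * ‖f ξ‖ ≤ m * (bracket ξ ^ t * ‖g ξ‖)) :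
    sobNorm s f ≤ |m| * sobNorm t g := by
  rw [← Real.norm_eq_abs, ← coe_nnnorm]
  refine (lpNorm_le_of_norm_le (hg.const_smul m) fun ξ => ?_).trans_eq (lpNorm_const_smul ..)
  rw [Pi.smul_apply, norm_smul, norm_bracket_pow_smul, norm_bracket_pow_smul]
  exact (h ξ).trans (mul_le_mul_of_nonneg_right (le_abs_self m)
    (mul_nonneg (pow_pos (bracket_pos ξ) t).le (norm_nonneg _)))

theorem bracket_pow_mul_norm_le (hst : s ≤ t) (f : ℝ → ℂ) (ξ : ℝ) :
    bracket ξ ^ s * ‖f ξ‖ ≤ 1 * (bracket ξ ^ t * ‖f ξ‖) := by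
  rw [one_mul]
  gcongr
  exact one_le_bracket ξ

theorem bracket_pow_mul_norm_freq_smul_le (s : ℕ) (f : ℝ → ℂ) (ξ : ℝ) :
    bracket ξ ^ s * ‖(freq • f) ξ‖ ≤ 1 * (bracket ξ ^ (s + 1) * ‖f ξ‖) := by
  have hb := bracket_pos ξ
  rw [Pi.smul_apply', norm_smul, Real.norm_eq_abs, one_mul, pow_succ, mul_assoc]
  gcongr
  exact abs_freq_le_bracket ξ

theorem MemSob.mono (hf : MemSob t f) (hst : s ≤ t) : MemSob s f :=
  hf.of_norm_le hf.aestronglyMeasurable (bracket_pow_mul_norm_le hst f)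

theorem sobNorm_mono (hf : MemSob t f) (hst : s ≤ t) : sobNorm s f ≤ sobNorm t f := by
  simpa using sobNorm_le_of_norm_le hf (bracket_pow_mul_norm_le hst f)

theorem MemSob.freq_smul (hf : MemSob (s + 1) f) : MemSob s (freq • f) :=
  hf.of_norm_le (continuous_freq.aestronglyMeasurable.smul hf.aestronglyMeasurable)
    (bracket_pow_mul_norm_freq_smul_le s f)

theorem sobNorm_freq_smul_le (hf : MemSob (s + 1) f) :
    sobNorm s (freq • f) ≤ sobNorm (s + 1) f := by
  simpa using sobNorm_le_of_norm_le hf (bracket_pow_mul_norm_freq_smul_le s f)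

theorem MemSob.memLp (hf : MemSob s f) : MemLp f 2 := memSob_zero.1 (hf.mono s.zero_le)

theorem lpNorm_le_sobNorm (hf : MemSob s f) : ‖f‖₂ ≤ sobNorm s f :=
  sobNorm_zero.symm.trans_le (sobNorm_mono hf s.zero_le)

theorem MemSob.memLp_freq_smul (hf : MemSob 1 f) : MemLp (freq • f) 2 :=
  memSob_zero.1 hf.freq_smul

theorem lpNorm_freq_smul_le_sobNorm (hf : MemSob 1 f) : ‖freq • f‖₂ ≤ sobNorm 1 f :=
  sobNorm_zero.symm.trans_le (sobNorm_freq_smul_le hf)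

theorem inv_bracket_smul_bracket_smul :
    (fun ξ => (bracket ξ)⁻¹) • bracket ^ 1 • f = f := funext fun ξ => by
  simp only [Pi.smul_apply', pow_one]
  exact inv_smul_smul₀ (bracket_pos ξ).ne' (f ξ)

theorem MemSob.integrable (hf : MemSob 1 f) : Integrable f := by
  rw [← inv_bracket_smul_bracket_smul (f := f), ← memLp_one_iff_integrable]
  exact MemLp.smul hf memLp_inv_bracket

theorem integral_norm_le_sobNorm (hf : MemSob 1 f) :
    ∫ ξ, ‖f ξ‖ ≤ bracketConst * sobNorm 1 f := by
  refine le_of_eq_of_le (integral_congr_ae <| ae_of_all _ fun ξ => ?_)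
    (integral_norm_mul_norm_le memLp_inv_bracket hf)
  rw [← norm_smul]
  exact (congrArg norm (congrFun inv_bracket_smul_bracket_smul ξ)).symm

end MemSob

/-! ### Bounds for the nonlinearity -/

/-- The function `u` is integrable, with `L¹` norm at most `B`. -/
structure HasL1Bound (u : ℝ → ℂ) (B : ℝ) : Prop where
  integrable : Integrable u
  integral_norm_le : ∫ ξ, ‖u ξ‖ ≤ B

namespace HasL1Bound

variable {u v : ℝ → ℂ} {A B : ℝ}

theorem mono (hu : HasL1Bound u A) (h : A ≤ B) : HasL1Bound u B :=
  ⟨hu.1, hu.2.trans h⟩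

theorem congr (hu : HasL1Bound u B) (h : u =ᵐ[volume] v) : HasL1Bound v B :=
  ⟨hu.1.congr h, (integral_congr_ae <| h.mono fun _ => congrArg norm).symm.trans_le hu.2⟩

theorem add (hu : HasL1Bound u A) (hv : HasL1Bound v B) : HasL1Bound (u + v) (A + B) := by
  refine ⟨hu.1.add hv.1, le_trans ?_ (add_le_add hu.2 hv.2)⟩
  rw [← integral_add hu.1.norm hv.1.norm]
  exact integral_mono (hu.1.add hv.1).norm (hu.1.norm.add hv.1.norm) fun ξ => norm_add_le _ _

theorem const_smul (hu : HasL1Bound u B) (c : ℂ) : HasL1Bound (c • u) (‖c‖ * B) := by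
  refine ⟨hu.1.smul c, ?_⟩
  simp only [Pi.smul_apply, norm_smul, integral_const_mul]
  gcongr
  exact hu.2

theorem norm_integral_le (hu : HasL1Bound u B) : ‖∫ ξ, u ξ‖ ≤ B :=
  (norm_integral_le_integral_norm u).trans hu.2

end HasL1Bound

section L1Bounds

variable {f g h l : ℝ → ℂ}

theorem hasL1Bound_mul_conv (hf : MemSob 1 f) (hg : MemLp g 2) (hh : MemLp h 2) :
    HasL1Bound (fun ξ => h (-ξ) * conv f g ξ) (bracketConst * sobNorm 1 f * (‖g‖₂ * ‖h‖₂)) := by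
  refine ⟨integrable_mul_conv (integrable_tripleKernel hf.integrable hg hh),
    (integral_norm_mul_conv_le hf.integrable hg hh).trans ?_⟩
  gcongr
  · exact mul_nonneg lpNorm_nonneg lpNorm_nonneg
  · exact integral_norm_le_sobNorm hf

theorem hasL1Bound_mul_of_bounded {B : ℝ} (hh : MemSob 1 h) (hf : AEStronglyMeasurable f)
    (hB : ∀ ξ, ‖f ξ‖ ≤ B) :
    HasL1Bound (fun ξ => h (-ξ) * f ξ) (bracketConst * sobNorm 1 h * B) := by
  have hi : Integrable fun ξ => h (-ξ) * f ξ :=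
    hh.integrable.comp_neg.mul_bdd (c := B) hf (ae_of_all _ hB)
  refine ⟨hi, (integral_mono hi.norm (hh.integrable.comp_neg.norm.mul_const B) fun ξ => ?_).trans
    (?_ : _ ≤ bracketConst * sobNorm 1 h * B)⟩
  · rw [norm_mul]
    gcongr
    exact hB ξ
  · rw [integral_mul_const, integral_neg_eq_self fun ξ => ‖h ξ‖]
    gcongr
    · exact (norm_nonneg _).trans (hB 0)
    · exact integral_norm_le_sobNorm hh

theorem hasL1Bound_mul_conv_conv (hh : MemSob 1 h) (hf : MemSob 1 f) (hg : MemSob 1 g)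
    (hl : MemSob 1 l) :
    HasL1Bound (fun ξ => h (-ξ) * conv f (conv g l) ξ)
      (bracketConst ^ 2 * (sobNorm 1 h * sobNorm 1 f * (sobNorm 1 g * sobNorm 1 l))) := by
  have hm := aestronglyMeasurable_conv hf.memLp.1 (aestronglyMeasurable_conv hg.memLp.1 hl.memLp.1)
  refine (hasL1Bound_mul_of_bounded hh hm
    (norm_conv_conv_le hf.integrable hg.memLp hl.memLp)).mono ?_
  calc bracketConst * sobNorm 1 h * ((∫ ξ, ‖f ξ‖) * (‖g‖₂ * ‖l‖₂))
      ≤ bracketConst * sobNorm 1 h *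
          (bracketConst * sobNorm 1 f * (sobNorm 1 g * sobNorm 1 l)) := by
        have := bracketConst_nonneg
        have := sobNorm_nonneg (s := 1) (f := h)
        have := sobNorm_nonneg (s := 1) (f := f)
        have := sobNorm_nonneg (s := 1) (f := g)
        gcongr
        exacts [mul_nonneg lpNorm_nonneg lpNorm_nonneg, integral_norm_le_sobNorm hf, lpNorm_nonneg,
          lpNorm_le_sobNorm hg, lpNorm_le_sobNorm hl]
    _ = _ := by ring

variable (f) in
theorem freq_smul_neg (ξ : ℝ) : (freq • f) (-ξ) = -(freq ξ * f (-ξ)) := by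
  simp only [Pi.smul_apply', freq, Complex.real_smul]
  push_cast
  ring

-- One of the two factors `k` of the symbol `γ k²` is moved to `h`, the other onto the convolution.
theorem mul_quadPart_eq (hf : MemSob 1 f) (γ ξ : ℝ) :
    h (-ξ) * quadPart γ f ξ = (3 / 4 : ℂ) * (h (-ξ) * conv f f ξ)
      + (2 * γ : ℂ) * ((freq • h) (-ξ) * conv f (freq • f) ξ)
      + (7 / 48 : ℂ) * (h (-ξ) * conv (freq • f) (freq • f) ξ) := by
  have hk := congrFun (freq_smul_conv_self hf.memLp hf.memLp_freq_smul) ξ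
  rw [Pi.smul_apply', Pi.smul_apply, Complex.real_smul, smul_eq_mul] at hk
  rw [quadPart, freq_smul_neg]
  push_cast
  linear_combination (-γ * freq ξ * h (-ξ) : ℂ) * hk

theorem hasL1Bound_mul_quadPart (hh : MemSob 1 h) (hf : MemSob 1 f) (γ : ℝ) :
    HasL1Bound (fun ξ => h (-ξ) * quadPart γ f ξ)
      ((1 + 2 * |γ|) * bracketConst * (sobNorm 1 h * sobNorm 1 f ^ 2)) := by
  have hk := hf.memLp_freq_smul
  have hC := bracketConst_nonneg
  have hF := sobNorm_nonneg (s := 1) (f := f)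
  have hH := sobNorm_nonneg (s := 1) (f := h)
  have hB : 0 ≤ bracketConst * (sobNorm 1 h * sobNorm 1 f ^ 2) := by positivity
  have bound {x u v y z : ℝ} (hx : 0 ≤ x) (hv : 0 ≤ v) (hu : u ≤ y) (hvz : v ≤ z) (hy : 0 ≤ y) :
      bracketConst * x * (u * v) ≤ bracketConst * (x * y * z) := by
    rw [mul_assoc, mul_assoc]
    gcongr
  have h₁ : HasL1Bound (fun ξ => h (-ξ) * conv f f ξ)
      (bracketConst * (sobNorm 1 h * sobNorm 1 f ^ 2)) :=
    (hasL1Bound_mul_conv hf hf.memLp hh.memLp).mono <|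
      (bound hF lpNorm_nonneg (lpNorm_le_sobNorm hf) (lpNorm_le_sobNorm hh) hF).trans_eq (by ring)
  have h₂ : HasL1Bound (fun ξ => (freq • h) (-ξ) * conv f (freq • f) ξ)
      (bracketConst * (sobNorm 1 h * sobNorm 1 f ^ 2)) :=
    (hasL1Bound_mul_conv hf hk hh.memLp_freq_smul).mono <|
      (bound hF lpNorm_nonneg (lpNorm_freq_smul_le_sobNorm hf)
        (lpNorm_freq_smul_le_sobNorm hh) hF).trans_eq (by ring)
  have h₃ : HasL1Bound (fun ξ => h (-ξ) * conv (freq • f) (freq • f) ξ)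
      (bracketConst * (sobNorm 1 h * sobNorm 1 f ^ 2)) :=
    (hasL1Bound_mul_of_bounded hh (aestronglyMeasurable_conv hk.1 hk.1)
      (norm_conv_le hk hk)).mono <| (bound hH lpNorm_nonneg (lpNorm_freq_smul_le_sobNorm hf)
        (lpNorm_freq_smul_le_sobNorm hf) hF).trans_eq (by ring)
  simp only [mul_quadPart_eq hf]
  refine (((h₁.const_smul (3 / 4)).add (h₂.const_smul (2 * γ))).add
    (h₃.const_smul (7 / 48))).mono ?_
  norm_num
  linarith

end L1Bounds

/-! ### The energy flux -/

/-- The symbol of `cosh(σ|D|)`. -/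
def coshSymbol (σ ξ : ℝ) : ℝ := Real.cosh (σ * freq ξ)

/-- The symbol of `sinh(σD)`, which measures the failure of `coshSymbol` to be multiplicative. -/
def sinhSymbol (σ ξ : ℝ) : ℝ := Real.sinh (σ * freq ξ)

/-- The difference between `coshSymbol σ • nonlin γ g` and `nonlin γ a`, for
`a = coshSymbol σ • g` and `b = sinhSymbol σ • g`. It is of second order in `b`. -/
def nonlinDefect (γ : ℝ) (a b : ℝ → ℂ) (ξ : ℝ) : ℂ :=
  quadPart γ b ξ - 1 / 8 * (conv a (conv b b) ξ + 2 * conv b (conv a b) ξ)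

/-- The density of the time derivative of the energy on the Fourier side. -/
def flux (σ γ : ℝ) (g : ℝ → ℂ) (ξ : ℝ) : ℂ :=
  conj ((coshSymbol σ • g) ξ) * (-Complex.I * freq ξ * (coshSymbol σ • nonlin γ g) ξ)

/-- The constant in the bounds for `flux`. -/
def fluxConst (γ : ℝ) : ℝ := (1 + 2 * |γ|) * bracketConst + bracketConst ^ 2

theorem abs_sinh_le_cosh (x : ℝ) : |Real.sinh x| ≤ Real.cosh x :=
  abs_le_of_sq_le_sq (by rw [Real.cosh_sq]; exact le_add_of_nonneg_right zero_le_one)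
    (Real.cosh_pos x).le

theorem abs_sinh_le_abs_mul_cosh (x : ℝ) : |Real.sinh x| ≤ |x| * Real.cosh x := by
  have h := (convex_Icc (-|x|) |x|).norm_image_sub_le_of_norm_hasDerivWithin_le
    (f := Real.sinh) (f' := Real.cosh) (C := Real.cosh x) (x := 0) (y := x)
    (fun y _ => (Real.hasDerivAt_sinh y).hasDerivWithinAt)
    (fun y hy => by
      rw [Real.norm_of_nonneg (Real.cosh_pos y).le, Real.cosh_le_cosh]
      exact abs_le.2 hy)
    ⟨by simp, by simp⟩ ⟨neg_abs_le x, le_abs_self x⟩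
  simpa only [Real.sinh_zero, sub_zero, Real.norm_eq_abs, mul_comm] using h

theorem abs_sinhSymbol_le {σ : ℝ} (hσ : 0 ≤ σ) (ξ : ℝ) :
    |sinhSymbol σ ξ| ≤ min 1 σ * bracket ξ * coshSymbol σ ξ := by
  have hc := Real.cosh_pos (σ * freq ξ)
  rcases le_total 1 σ with h | h
  · rw [min_eq_left h, one_mul]
    exact (abs_sinh_le_cosh _).trans (le_mul_of_one_le_left hc.le (one_le_bracket ξ))
  · rw [min_eq_right h]
    refine (abs_sinh_le_abs_mul_cosh _).trans (mul_le_mul_of_nonneg_right ?_ hc.le)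
    rw [abs_mul, abs_of_nonneg hσ]
    exact mul_le_mul_of_nonneg_left (abs_freq_le_bracket ξ) hσ

theorem coshSymbol_pos (σ ξ : ℝ) : 0 < coshSymbol σ ξ := Real.cosh_pos _

theorem continuous_coshSymbol (σ : ℝ) : Continuous (coshSymbol σ) :=
  Real.continuous_cosh.comp (continuous_freq.const_mul σ)

theorem continuous_sinhSymbol (σ : ℝ) : Continuous (sinhSymbol σ) :=
  Real.continuous_sinh.comp (continuous_freq.const_mul σ)

theorem coshSymbol_neg (σ ξ : ℝ) : coshSymbol σ (-ξ) = coshSymbol σ ξ := by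
  simp only [coshSymbol, freq, mul_neg, Real.cosh_neg]

section Flux

variable {σ γ X : ℝ} {f g a b h : ℝ → ℂ} {s : ℕ}

theorem bracket_pow_mul_norm_sinhSymbol_smul_le (hσ : 0 ≤ σ) (s : ℕ) (g : ℝ → ℂ) (ξ : ℝ) :
    bracket ξ ^ s * ‖(sinhSymbol σ • g) ξ‖
      ≤ min 1 σ * (bracket ξ ^ (s + 1) * ‖(coshSymbol σ • g) ξ‖) := by
  have hb := bracket_pos ξ
  rw [Pi.smul_apply', Pi.smul_apply', norm_smul, norm_smul, Real.norm_eq_abs,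
    Real.norm_of_nonneg (coshSymbol_pos σ ξ).le]
  calc _ ≤ bracket ξ ^ s * (min 1 σ * bracket ξ * coshSymbol σ ξ * ‖g ξ‖) := by
        gcongr
        exact abs_sinhSymbol_le hσ ξ
    _ = _ := by ring

theorem MemSob.sinhSymbol_smul (hσ : 0 ≤ σ) (ha : MemSob (s + 1) (coshSymbol σ • g)) :
    MemSob s (sinhSymbol σ • g) :=
  ha.of_norm_le ((continuous_sinhSymbol σ).aestronglyMeasurable.smul
    (aestronglyMeasurable_of_smul (continuous_coshSymbol σ) (fun ξ => (coshSymbol_pos σ ξ).ne')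
      ha.aestronglyMeasurable)) (bracket_pow_mul_norm_sinhSymbol_smul_le hσ s g)

theorem sobNorm_sinhSymbol_smul_le (hσ : 0 ≤ σ) (ha : MemSob (s + 1) (coshSymbol σ • g)) :
    sobNorm s (sinhSymbol σ • g) ≤ min 1 σ * sobNorm (s + 1) (coshSymbol σ • g) := by
  simpa only [abs_of_nonneg (le_min zero_le_one hσ)] using
    sobNorm_le_of_norm_le ha (bracket_pow_mul_norm_sinhSymbol_smul_le hσ s g)

theorem coshSymbol_smul_conv (hcf : MemLp (coshSymbol σ • f) 2) (hcg : MemLp (coshSymbol σ • g) 2)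
    (hsf : MemLp (sinhSymbol σ • f) 2) (hsg : MemLp (sinhSymbol σ • g) 2) :
    coshSymbol σ • conv f g = conv (coshSymbol σ • f) (coshSymbol σ • g)
      + conv (sinhSymbol σ • f) (sinhSymbol σ • g) := funext fun ξ => by
  rw [Pi.add_apply, conv, conv, ← integral_add (integrable_conv_integrand hcf hcg ξ)
    (integrable_conv_integrand hsf hsg ξ), Pi.smul_apply', conv, ← integral_smul]
  refine integral_congr_ae (ae_of_all _ fun ζ => ?_)
  have e : σ * freq ξ = σ * freq ζ + σ * freq (ξ - ζ) := by simp only [freq]; ring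
  simp only [Pi.smul_apply', coshSymbol, sinhSymbol, Complex.real_smul, e, Real.cosh_add]
  push_cast
  ring

theorem sinhSymbol_smul_conv (hcf : MemLp (coshSymbol σ • f) 2) (hcg : MemLp (coshSymbol σ • g) 2)
    (hsf : MemLp (sinhSymbol σ • f) 2) (hsg : MemLp (sinhSymbol σ • g) 2) :
    sinhSymbol σ • conv f g = conv (sinhSymbol σ • f) (coshSymbol σ • g)
      + conv (coshSymbol σ • f) (sinhSymbol σ • g) := funext fun ξ => by
  rw [Pi.add_apply, conv, conv, ← integral_add (integrable_conv_integrand hsf hcg ξ)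
    (integrable_conv_integrand hcf hsg ξ), Pi.smul_apply', conv, ← integral_smul]
  refine integral_congr_ae (ae_of_all _ fun ζ => ?_)
  have e : σ * freq ξ = σ * freq ζ + σ * freq (ξ - ζ) := by simp only [freq]; ring
  simp only [Pi.smul_apply', coshSymbol, sinhSymbol, Complex.real_smul, e, Real.sinh_add]
  push_cast
  ring

theorem coshSymbol_smul_quadPart (ha : MemSob 1 (coshSymbol σ • g))
    (hb : MemSob 1 (sinhSymbol σ • g)) :
    coshSymbol σ • quadPart γ g
      = quadPart γ (coshSymbol σ • g) + quadPart γ (sinhSymbol σ • g) := funext fun ξ => by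
  have hk := ha.memLp_freq_smul
  have hkb := hb.memLp_freq_smul
  rw [smul_comm] at hk hkb
  have h₁ := congrFun (coshSymbol_smul_conv ha.memLp ha.memLp hb.memLp hb.memLp) ξ
  have h₂ := congrFun (coshSymbol_smul_conv hk hk hkb hkb) ξ
  simp only [Pi.smul_apply', Pi.add_apply, Complex.real_smul, quadPart] at h₁ h₂ ⊢
  rw [smul_comm freq, smul_comm freq]
  linear_combination ((3 / 4 - γ * freq ξ ^ 2 : ℝ) : ℂ) * h₁ + 7 / 48 * h₂

theorem coshSymbol_smul_conv_conv (ha : MemSob 1 (coshSymbol σ • g))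
    (hb : MemSob 1 (sinhSymbol σ • g)) :
    coshSymbol σ • conv g (conv g g)
      = conv (coshSymbol σ • g) (conv (coshSymbol σ • g) (coshSymbol σ • g))
        + (conv (coshSymbol σ • g) (conv (sinhSymbol σ • g) (sinhSymbol σ • g))
        + (2 : ℂ) • conv (sinhSymbol σ • g) (conv (coshSymbol σ • g) (sinhSymbol σ • g))) := by
  have haa := memLp_conv ha.integrable ha.integrable ha.memLp ha.memLp
  have hbb := memLp_conv hb.integrable hb.integrable hb.memLp hb.memLp
  have hab := memLp_conv ha.integrable hb.integrable ha.memLp hb.memLp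
  have hc := coshSymbol_smul_conv ha.memLp ha.memLp hb.memLp hb.memLp
  have hs := sinhSymbol_smul_conv ha.memLp ha.memLp hb.memLp hb.memLp
  rw [conv_comm (sinhSymbol σ • g)] at hs
  rw [coshSymbol_smul_conv ha.memLp (hc ▸ haa.add hbb) hb.memLp (hs ▸ hab.add hab), hc, hs,
    conv_add_right ha.memLp haa hbb, conv_add_right hb.memLp hab hab, two_smul, add_assoc]

theorem coshSymbol_smul_nonlin (ha : MemSob 1 (coshSymbol σ • g))
    (hb : MemSob 1 (sinhSymbol σ • g)) :
    coshSymbol σ • nonlin γ g = nonlin γ (coshSymbol σ • g)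
      + nonlinDefect γ (coshSymbol σ • g) (sinhSymbol σ • g) := funext fun ξ => by
  have h₁ := congrFun (coshSymbol_smul_quadPart (γ := γ) ha hb) ξ
  have h₂ := congrFun (coshSymbol_smul_conv_conv ha hb) ξ
  simp only [Pi.smul_apply', Pi.smul_apply, Pi.add_apply, Complex.real_smul, nonlin, nonlinDefect,
    smul_eq_mul] at h₁ h₂ ⊢
  linear_combination h₁ - 1 / 8 * h₂

theorem le_mul_fluxConst_mul {c p q : ℝ} (hc : 0 ≤ c) (hX : 0 ≤ X) (hp : p ≤ c * X ^ 3)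
    (hq : q ≤ c * X ^ 4) :
    (1 + 2 * |γ|) * bracketConst * p + bracketConst ^ 2 * q
      ≤ c * (fluxConst γ * ((1 + X) * X ^ 3)) := by
  have hC := bracketConst_nonneg
  calc _ ≤ (1 + 2 * |γ|) * bracketConst * (c * X ^ 3) + bracketConst ^ 2 * (c * X ^ 4) := by gcongr
    _ ≤ (1 + 2 * |γ|) * bracketConst * (c * X ^ 3) + bracketConst ^ 2 * (c * X ^ 4)
        + (1 + 2 * |γ|) * bracketConst * (c * X ^ 4) + bracketConst ^ 2 * (c * X ^ 3) := by
      rw [add_assoc]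
      exact le_add_of_nonneg_right (by positivity)
    _ = _ := by unfold fluxConst; ring

theorem fluxConst_nonneg (γ : ℝ) : 0 ≤ fluxConst γ := by
  have hC := bracketConst_nonneg
  unfold fluxConst
  positivity

theorem hasL1Bound_mul_nonlin (hh : MemSob 1 h) (ha : MemSob 1 a) (hhX : sobNorm 1 h ≤ X)
    (haX : sobNorm 1 a ≤ X) :
    HasL1Bound (fun ξ => h (-ξ) * nonlin γ a ξ) (fluxConst γ * ((1 + X) * X ^ 3)) := by
  have hX : 0 ≤ X := sobNorm_nonneg.trans haX
  have hA := sobNorm_nonneg (s := 1) (f := a)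
  have hp : sobNorm 1 h * sobNorm 1 a ^ 2 ≤ 1 * X ^ 3 :=
    (by gcongr : _ ≤ X * X ^ 2).trans_eq (by ring)
  have hq : sobNorm 1 h * sobNorm 1 a * (sobNorm 1 a * sobNorm 1 a) ≤ 1 * X ^ 4 :=
    (by gcongr : _ ≤ X * X * (X * X)).trans_eq (by ring)
  have hbound := (hasL1Bound_mul_quadPart hh ha γ).add
    ((hasL1Bound_mul_conv_conv hh ha ha ha).const_smul (-1 / 8))
  refine (hbound.mono ?_).congr (ae_of_all _ fun ξ => ?_)
  · have hle := le_mul_fluxConst_mul (γ := γ) zero_le_one hX hp hq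
    have h0 : 0 ≤ bracketConst ^ 2 *
        (sobNorm 1 h * sobNorm 1 a * (sobNorm 1 a * sobNorm 1 a)) := by
      have := sobNorm_nonneg (s := 1) (f := h)
      positivity
    norm_num
    linarith
  · simp only [Pi.add_apply, Pi.smul_apply, smul_eq_mul, nonlin]
    ring

theorem hasL1Bound_mul_nonlinDefect {m : ℝ} (hm : 0 ≤ m) (hh : MemSob 1 h) (ha : MemSob 1 a)
    (hb : MemSob 1 b) (hhX : sobNorm 1 h ≤ X) (haX : sobNorm 1 a ≤ X)
    (hbX : sobNorm 1 b ≤ m * X) :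
    HasL1Bound (fun ξ => h (-ξ) * nonlinDefect γ a b ξ)
      (m ^ 2 * (fluxConst γ * ((1 + X) * X ^ 3))) := by
  have hX : 0 ≤ X := sobNorm_nonneg.trans haX
  have hA := sobNorm_nonneg (s := 1) (f := a)
  have hB := sobNorm_nonneg (s := 1) (f := b)
  have hH := sobNorm_nonneg (s := 1) (f := h)
  have hp : sobNorm 1 h * sobNorm 1 b ^ 2 ≤ m ^ 2 * X ^ 3 :=
    (by gcongr : _ ≤ X * (m * X) ^ 2).trans_eq (by ring)
  have hq : sobNorm 1 h * sobNorm 1 a * (sobNorm 1 b * sobNorm 1 b) ≤ m ^ 2 * X ^ 4 :=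
    (by gcongr : _ ≤ X * X * ((m * X) * (m * X))).trans_eq (by ring)
  have hbound := ((hasL1Bound_mul_quadPart hh hb γ).add
    ((hasL1Bound_mul_conv_conv hh ha hb hb).const_smul (-1 / 8))).add
    ((hasL1Bound_mul_conv_conv hh hb ha hb).const_smul (-1 / 4))
  refine (hbound.mono ?_).congr (ae_of_all _ fun ξ => ?_)
  · have hle := le_mul_fluxConst_mul (γ := γ) (sq_nonneg m) hX hp hq
    have h0 : 0 ≤ bracketConst ^ 2 *
        (sobNorm 1 h * sobNorm 1 a * (sobNorm 1 b * sobNorm 1 b)) := by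
      positivity
    rw [show sobNorm 1 h * sobNorm 1 b * (sobNorm 1 a * sobNorm 1 b)
      = sobNorm 1 h * sobNorm 1 a * (sobNorm 1 b * sobNorm 1 b) by ring]
    norm_num
    linarith
  · simp only [Pi.add_apply, Pi.smul_apply, smul_eq_mul, nonlinDefect]
    ring

theorem conj_coshSymbol_smul_ae (hherm : ∀ᵐ ξ, g (-ξ) = conj (g ξ)) :
    ∀ᵐ ξ, conj ((coshSymbol σ • g) ξ) = (coshSymbol σ • g) (-ξ) := by
  filter_upwards [hherm] with ξ h
  simp only [Pi.smul_apply', h, coshSymbol_neg, Complex.real_smul, map_mul, Complex.conj_ofReal]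

theorem flux_ae_eq (ha : MemSob 1 (coshSymbol σ • g)) (hb : MemSob 1 (sinhSymbol σ • g))
    (hherm : ∀ᵐ ξ, g (-ξ) = conj (g ξ)) :
    flux σ γ g =ᵐ[volume] Complex.I •
      ((fun ξ => (freq • coshSymbol σ • g) (-ξ) * nonlin γ (coshSymbol σ • g) ξ)
      + fun ξ => (freq • coshSymbol σ • g) (-ξ)
          * nonlinDefect γ (coshSymbol σ • g) (sinhSymbol σ • g) ξ) := by
  filter_upwards [conj_coshSymbol_smul_ae hherm] with ξ h
  rw [flux, h, coshSymbol_smul_nonlin ha hb]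
  simp only [Pi.smul_apply, Pi.add_apply, freq_smul_neg, smul_eq_mul]
  ring

theorem hasL1Bound_flux (hσ : 0 ≤ σ) (ha : MemSob 2 (coshSymbol σ • g))
    (hherm : ∀ᵐ ξ, g (-ξ) = conj (g ξ)) :
    HasL1Bound (flux σ γ g) (2 * fluxConst γ * ((1 + sobNorm 2 (coshSymbol σ • g))
      * sobNorm 2 (coshSymbol σ • g) ^ 3)) := by
  set X := sobNorm 2 (coshSymbol σ • g)
  have hX : 0 ≤ X := sobNorm_nonneg
  have ha1 := ha.mono one_le_two
  have hb := ha.sinhSymbol_smul hσ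
  have haX : sobNorm 1 (coshSymbol σ • g) ≤ X := sobNorm_mono ha one_le_two
  have hbX : sobNorm 1 (sinhSymbol σ • g) ≤ 1 * X := (sobNorm_sinhSymbol_smul_le hσ ha).trans
    (mul_le_mul_of_nonneg_right (min_le_left 1 σ) hX)
  have hkX : sobNorm 1 (freq • coshSymbol σ • g) ≤ X := sobNorm_freq_smul_le ha
  have hbound := ((hasL1Bound_mul_nonlin (γ := γ) ha.freq_smul ha1 hkX haX).add
    (hasL1Bound_mul_nonlinDefect (γ := γ) zero_le_one ha.freq_smul ha1 hb hkX haX hbX)).const_smul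
      Complex.I
  refine (hbound.congr (flux_ae_eq ha1 hb hherm).symm).mono (le_of_eq ?_)
  rw [Complex.norm_I]
  ring

-- The `3/4` part and the quartic part vanish by themselves; the cubic terms with three derivatives
-- cancel because `7/48` is also the coefficient of `(∂ₓη)²`.
theorem integral_mul_nonlin_eq_zero (ha : MemSob 2 a) :
    ∫ ξ, (freq • a) (-ξ) * nonlin (7 / 48) a ξ = 0 := by
  have ha1 := ha.mono one_le_two
  have hk : MemSob 1 (freq • a) := ha.freq_smul
  have i₁ := integrable_tripleKernel ha1.integrable ha1.memLp hk.memLp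
  have i₂ := integrable_tripleKernel ha1.integrable hk.memLp hk.memLp_freq_smul
  have i₃ := integrable_tripleKernel hk.integrable hk.memLp hk.memLp
  have i₄ := integrable_tripleKernel ha1.integrable (memLp_conv ha1.integrable ha1.integrable
    ha1.memLp ha1.memLp) hk.memLp
  have j₁ := (integrable_mul_conv i₁).const_mul (3 / 4)
  have j₂ := (integrable_mul_conv i₂).const_mul (2 * (7 / 48 : ℝ))
  have j₃ := (integrable_mul_conv i₃).const_mul (7 / 48)
  have j₄ := (integrable_mul_conv i₄).const_mul (1 / 8)
  simp only [nonlin, mul_sub, mul_quadPart_eq ha1, mul_left_comm _ (1 / 8 : ℂ)]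
  rw [integral_sub (by exact (j₁.add j₂).add j₃) j₄, integral_add (by exact j₁.add j₂) j₃,
    integral_add j₁ j₂]
  simp only [integral_const_mul, integral_mul_conv i₁, integral_mul_conv i₂, integral_mul_conv i₃,
    integral_mul_conv i₄]
  have h₁ := triple_self_self_freq_smul ha1.integrable ha1.memLp hk.memLp
  have h₂ := two_mul_triple_freq_smul_freq_smul ha1.integrable hk.integrable hk.memLp
    hk.memLp_freq_smul
  have h₃ := triple_self_conv_freq_smul ha1.integrable ha1.memLp hk.integrable hk.memLp
  push_cast
  linear_combination (3 / 4) * h₁ + (7 / 48) * h₂ - (1 / 8) * h₃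

theorem norm_integral_flux_le (hσ : 0 ≤ σ) (ha : MemSob 2 (coshSymbol σ • g))
    (hherm : ∀ᵐ ξ, g (-ξ) = conj (g ξ)) :
    ‖∫ ξ, flux σ (7 / 48) g ξ‖ ≤ min 1 σ ^ 2 * (fluxConst (7 / 48)
      * ((1 + sobNorm 2 (coshSymbol σ • g)) * sobNorm 2 (coshSymbol σ • g) ^ 3)) := by
  have ha1 := ha.mono one_le_two
  have hb := ha.sinhSymbol_smul hσ
  have haX := sobNorm_mono ha one_le_two
  have hkX := sobNorm_freq_smul_le ha
  have hdefect := hasL1Bound_mul_nonlinDefect (γ := 7 / 48) (le_min zero_le_one hσ) ha.freq_smul ha1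
    hb hkX haX (sobNorm_sinhSymbol_smul_le hσ ha)
  rw [integral_congr_ae (flux_ae_eq ha1 hb hherm)]
  simp only [Pi.smul_apply, Pi.add_apply]
  rw [integral_smul, integral_add (hasL1Bound_mul_nonlin ha.freq_smul ha1 hkX haX).1 hdefect.1,
    integral_mul_nonlin_eq_zero ha, zero_add, norm_smul, Complex.norm_I, one_mul]
  exact hdefect.norm_integral_le

end Flux

/-! ### Lipschitz bounds for the nonlinearity -/

/-- The Lipschitz constant of `⟨k⟩⁻² nonlin` on the ball of radius `B` of `H¹`. -/
def nonlinLip (γ B : ℝ) : ℝ :=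
  2 * (3 / 4 + |γ| + 7 / 48) * B + 3 / 8 * bracketConst * B ^ 2

section Lipschitz

variable {γ B : ℝ} {f g : ℝ → ℂ}

theorem MemSob.sub {s : ℕ} (hf : MemSob s f) (hg : MemSob s g) : MemSob s (f - g) := by
  rw [MemSob, smul_sub]
  exact MemLp.sub hf hg

theorem conv_self_sub_conv_self (hf : MemLp f 2) (hg : MemLp g 2) :
    conv f f - conv g g = conv f (f - g) + conv g (f - g) := by
  have hd := hf.sub hg
  have h₁ := conv_add_right hf hg hd
  have h₂ := conv_add_right hg hg hd
  rw [add_sub_cancel] at h₁ h₂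
  rw [h₁, conv_comm f g, h₂]
  abel

theorem norm_conv_self_sub_le (hf : MemLp f 2) (hg : MemLp g 2) (hfB : ‖f‖₂ ≤ B)
    (hgB : ‖g‖₂ ≤ B) (ξ : ℝ) : ‖conv f f ξ - conv g g ξ‖ ≤ 2 * B * ‖f - g‖₂ := by
  have h := congrFun (conv_self_sub_conv_self hf hg) ξ
  rw [Pi.sub_apply, Pi.add_apply] at h
  have hd : 0 ≤ ‖f - g‖₂ := lpNorm_nonneg
  calc ‖conv f f ξ - conv g g ξ‖ ≤ ‖conv f (f - g) ξ‖ + ‖conv g (f - g) ξ‖ := by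
        rw [h]
        exact norm_add_le _ _
    _ ≤ ‖f‖₂ * ‖f - g‖₂ + ‖g‖₂ * ‖f - g‖₂ :=
        add_le_add (norm_conv_le hf (hf.sub hg) ξ) (norm_conv_le hg (hf.sub hg) ξ)
    _ ≤ B * ‖f - g‖₂ + B * ‖f - g‖₂ := by gcongr
    _ = 2 * B * ‖f - g‖₂ := by ring

theorem conv_conv_self_sub (hf : MemSob 1 f) (hg : MemSob 1 g) :
    conv f (conv f f) - conv g (conv g g)
      = conv (f - g) (conv f f) + conv g (conv f f - conv g g) := by
  have hff := memLp_conv hf.integrable hf.integrable hf.memLp hf.memLp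
  have hgg := memLp_conv hg.integrable hg.integrable hg.memLp hg.memLp
  have h₁ := conv_add_right hff hg.memLp (hf.sub hg).memLp
  have h₂ := conv_add_right hg.memLp hgg (hff.sub hgg)
  rw [add_sub_cancel] at h₁ h₂
  rw [conv_comm f (conv f f), h₁, conv_comm (conv f f) g, h₂, conv_comm (conv f f)]
  abel

theorem norm_conv_conv_self_sub_le (hf : MemSob 1 f) (hg : MemSob 1 g) (hfB : sobNorm 1 f ≤ B)
    (hgB : sobNorm 1 g ≤ B) (ξ : ℝ) :
    ‖conv f (conv f f) ξ - conv g (conv g g) ξ‖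
      ≤ 3 * bracketConst * B ^ 2 * sobNorm 1 (f - g) := by
  have h := congrFun (conv_conv_self_sub hf hg) ξ
  rw [Pi.sub_apply, Pi.add_apply] at h
  have hB : 0 ≤ B := sobNorm_nonneg.trans hfB
  have hC := bracketConst_nonneg
  have hd := sobNorm_nonneg (s := 1) (f := f - g)
  have hfB' := (lpNorm_le_sobNorm hf).trans hfB
  have hgB' := (lpNorm_le_sobNorm hg).trans hgB
  have hff : ∀ ζ, ‖conv f f ζ‖ ≤ B * B := fun ζ =>
    (norm_conv_le hf.memLp hf.memLp ζ).trans (mul_le_mul hfB' hfB' lpNorm_nonneg hB)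
  have hfg : ∀ ζ, ‖(conv f f - conv g g) ζ‖ ≤ 2 * B * sobNorm 1 (f - g) := fun ζ =>
    (norm_conv_self_sub_le hf.memLp hg.memLp hfB' hgB' ζ).trans
      (mul_le_mul_of_nonneg_left (lpNorm_le_sobNorm (hf.sub hg)) (by positivity))
  calc ‖conv f (conv f f) ξ - conv g (conv g g) ξ‖
      ≤ ‖conv (f - g) (conv f f) ξ‖ + ‖conv g (conv f f - conv g g) ξ‖ := by
        rw [h]
        exact norm_add_le _ _
    _ ≤ (∫ ζ, ‖(f - g) ζ‖) * (B * B) + (∫ ζ, ‖g ζ‖) * (2 * B * sobNorm 1 (f - g)) :=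
        add_le_add (norm_conv_le_of_bounded (hf.sub hg).integrable hff ξ)
          (norm_conv_le_of_bounded hg.integrable hfg ξ)
    _ ≤ bracketConst * sobNorm 1 (f - g) * (B * B)
        + bracketConst * B * (2 * B * sobNorm 1 (f - g)) := by
        gcongr
        · exact integral_norm_le_sobNorm (hf.sub hg)
        · exact (integral_norm_le_sobNorm hg).trans (by gcongr)
    _ = 3 * bracketConst * B ^ 2 * sobNorm 1 (f - g) := by ring

theorem abs_const_sub_mul_freq_sq_le (ξ : ℝ) :
    |3 / 4 - γ * freq ξ ^ 2| ≤ bracket ξ ^ 2 * (3 / 4 + |γ|) := by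
  have h := abs_sub (3 / 4) (γ * freq ξ ^ 2)
  rw [abs_mul, abs_of_nonneg (sq_nonneg (freq ξ)), abs_of_pos (show (0 : ℝ) < 3 / 4 by norm_num)]
    at h
  rw [sq_bracket]
  nlinarith [abs_nonneg γ, sq_nonneg (freq ξ)]

theorem nonlin_sub_nonlin (γ : ℝ) (f g : ℝ → ℂ) (ξ : ℝ) :
    nonlin γ f ξ - nonlin γ g ξ
      = ((3 / 4 - γ * freq ξ ^ 2 : ℝ) : ℂ) * (conv f f ξ - conv g g ξ)
        + ((7 / 48 : ℝ) : ℂ) * (conv (freq • f) (freq • f) ξ - conv (freq • g) (freq • g) ξ)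
        - ((1 / 8 : ℝ) : ℂ) * (conv f (conv f f) ξ - conv g (conv g g) ξ) := by
  simp only [nonlin, quadPart]
  push_cast
  ring

theorem norm_nonlin_sub_le (hf : MemSob 1 f) (hg : MemSob 1 g) (hfB : sobNorm 1 f ≤ B)
    (hgB : sobNorm 1 g ≤ B) (ξ : ℝ) :
    ‖nonlin γ f ξ - nonlin γ g ξ‖ ≤ bracket ξ ^ 2 * (nonlinLip γ B * sobNorm 1 (f - g)) := by
  have hB : 0 ≤ B := sobNorm_nonneg.trans hfB
  have hb : 1 ≤ bracket ξ ^ 2 := one_le_pow₀ (one_le_bracket ξ)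
  have h₁ : ‖conv f f ξ - conv g g ξ‖ ≤ 2 * B * sobNorm 1 (f - g) :=
    (norm_conv_self_sub_le hf.memLp hg.memLp ((lpNorm_le_sobNorm hf).trans hfB)
      ((lpNorm_le_sobNorm hg).trans hgB) ξ).trans
      (mul_le_mul_of_nonneg_left (lpNorm_le_sobNorm (hf.sub hg)) (by positivity))
  have h₂ : ‖conv (freq • f) (freq • f) ξ - conv (freq • g) (freq • g) ξ‖
      ≤ 2 * B * sobNorm 1 (f - g) := by
    refine (norm_conv_self_sub_le hf.memLp_freq_smul hg.memLp_freq_smul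
      ((lpNorm_freq_smul_le_sobNorm hf).trans hfB)
      ((lpNorm_freq_smul_le_sobNorm hg).trans hgB) ξ).trans ?_
    rw [← smul_sub]
    exact mul_le_mul_of_nonneg_left (lpNorm_freq_smul_le_sobNorm (hf.sub hg)) (by positivity)
  have h₃ := norm_conv_conv_self_sub_le hf hg hfB hgB ξ
  calc ‖nonlin γ f ξ - nonlin γ g ξ‖
      ≤ |3 / 4 - γ * freq ξ ^ 2| * ‖conv f f ξ - conv g g ξ‖
        + 7 / 48 * ‖conv (freq • f) (freq • f) ξ - conv (freq • g) (freq • g) ξ‖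
        + 1 / 8 * ‖conv f (conv f f) ξ - conv g (conv g g) ξ‖ := by
        rw [nonlin_sub_nonlin]
        refine (norm_sub_le _ _).trans (add_le_add ((norm_add_le _ _).trans_eq ?_) ?_) <;>
          simp only [norm_mul, Complex.norm_real, Real.norm_eq_abs] <;> norm_num
    _ ≤ bracket ξ ^ 2 * (3 / 4 + |γ|) * (2 * B * sobNorm 1 (f - g))
        + bracket ξ ^ 2 * (7 / 48) * (2 * B * sobNorm 1 (f - g))
        + bracket ξ ^ 2 * (1 / 8) * (3 * bracketConst * B ^ 2 * sobNorm 1 (f - g)) := by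
        gcongr
        · exact abs_const_sub_mul_freq_sq_le ξ
        · exact le_mul_of_one_le_left (by norm_num) hb
        · exact le_mul_of_one_le_left (by norm_num) hb
    _ = bracket ξ ^ 2 * (nonlinLip γ B * sobNorm 1 (f - g)) := by
        rw [nonlinLip]
        ring

theorem aestronglyMeasurable_nonlin (hg : MemSob 1 g) : AEStronglyMeasurable (nonlin γ g) := by
  have hgm := hg.aestronglyMeasurable
  have hq : Continuous fun ξ => ((3 / 4 - γ * freq ξ ^ 2 : ℝ) : ℂ) := by
    have := continuous_freq
    fun_prop
  have hgg := aestronglyMeasurable_conv hgm hgm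
  have hk := hg.memLp_freq_smul.1
  exact ((hq.aestronglyMeasurable.mul hgg).add ((aestronglyMeasurable_conv hk hk).const_mul _)).sub
    ((aestronglyMeasurable_conv hgm hgg).const_mul _)

end Lipschitz

/-! ### The truncated flow -/

section Truncation

variable {γ γ₂ δ₂ B : ℝ} {b : ℝ → ℝ} {f g : ℝ → ℂ}

theorem smul_rhs_sub (b : ℝ → ℝ) (f g : ℝ → ℂ) :
    b • rhs γ γ₂ δ₂ f - b • rhs γ γ₂ δ₂ g
      = (b * (freq * fun ξ => 1 - γ₂ * freq ξ ^ 2 + δ₂ * freq ξ ^ 4)) • (-Complex.I) • (f - g)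
        + (b * freq) • (-Complex.I) • (nonlin γ f - nonlin γ g) := by
  funext ξ
  simp only [rhs, Pi.add_apply, Pi.sub_apply, Pi.mul_apply, Pi.smul_apply', Pi.smul_apply,
    Complex.real_smul, smul_eq_mul]
  push_cast
  ring

theorem lpNorm_le_mul_of_norm_le {α E F : Type*} [MeasurableSpace α] {μ : Measure α}
    [NormedAddCommGroup E] [NormedAddCommGroup F] [NormedSpace ℝ F] {p : ENNReal} {f : α → E}
    {g : α → F} {c : ℝ} (hc : 0 ≤ c) (hg : MemLp g p μ) (h : ∀ x, ‖f x‖ ≤ c * ‖g x‖) :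
    lpNorm f p μ ≤ c * lpNorm g p μ := by
  have h' : lpNorm f p μ ≤ lpNorm (c • g) p μ := lpNorm_le_of_norm_le (hg.const_smul c) fun x => by
    rw [Pi.smul_apply, norm_smul, Real.norm_of_nonneg hc]
    exact h x
  rwa [lpNorm_const_smul, coe_nnnorm, Real.norm_of_nonneg hc] at h'

theorem exists_bound_smul {p : ℝ → ℝ} (hp : Continuous p) (hpc : HasCompactSupport p) :
    ∃ C, 0 ≤ C ∧ ∀ f : ℝ → ℂ, MemLp f 2 → MemLp (p • f) 2 ∧ ‖p • f‖₂ ≤ C * ‖f‖₂ := by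
  obtain ⟨C, hC⟩ := hpc.exists_bound_of_continuous hp
  have hC0 : 0 ≤ C := (norm_nonneg _).trans (hC 0)
  have hle : ∀ (f : ℝ → ℂ) ξ, ‖(p • f) ξ‖ ≤ C * ‖f ξ‖ := fun f ξ => by
    rw [Pi.smul_apply', norm_smul]
    exact mul_le_mul_of_nonneg_right (hC ξ) (norm_nonneg _)
  refine ⟨C, hC0, fun f hf => ⟨.of_le_mul hf (hp.aestronglyMeasurable.smul hf.1)
    (ae_of_all _ (hle f)), lpNorm_le_mul_of_norm_le hC0 hf (hle f)⟩⟩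

theorem exists_bound_smul_of_norm_le {p : ℝ → ℝ} (hp : Continuous p) (hpc : HasCompactSupport p) :
    ∃ C, ∀ (f : ℝ → ℂ) (K : ℝ), AEStronglyMeasurable f → (∀ ξ, ‖f ξ‖ ≤ bracket ξ ^ 2 * K) →
      MemLp (p • f) 2 ∧ ‖p • f‖₂ ≤ K * C := by
  have hq : MemLp (p * bracket ^ 2) 2 :=
    (hp.mul (continuous_bracket.pow 2)).memLp_of_hasCompactSupport hpc.mul_right
  refine ⟨‖p * bracket ^ 2‖₂, fun f K hf hK => ?_⟩
  have hK0 : 0 ≤ K := nonneg_of_mul_nonneg_right ((norm_nonneg _).trans (hK 0))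
    (pow_pos (bracket_pos 0) 2)
  have hle : ∀ ξ, ‖(p • f) ξ‖ ≤ K * ‖(p * bracket ^ 2) ξ‖ := fun ξ => by
    rw [Pi.smul_apply', Pi.mul_apply, Pi.pow_apply, norm_smul, norm_mul, norm_pow,
      Real.norm_of_nonneg (bracket_pos ξ).le, mul_left_comm, mul_comm K]
    exact mul_le_mul_of_nonneg_left (hK ξ) (norm_nonneg _)
  exact ⟨.of_le_mul hq (hp.aestronglyMeasurable.smul hf) (ae_of_all _ hle),
    lpNorm_le_mul_of_norm_le hK0 hq hle⟩

theorem exists_lipschitz_smul_rhs (γ γ₂ δ₂ B : ℝ) (hb : Continuous b) (hbc : HasCompactSupport b) :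
    ∃ L, ∀ f g, MemSob 1 f → MemSob 1 g → sobNorm 1 f ≤ B → sobNorm 1 g ≤ B →
      MemLp (b • rhs γ γ₂ δ₂ f - b • rhs γ γ₂ δ₂ g) 2 ∧
      ‖b • rhs γ γ₂ δ₂ f - b • rhs γ γ₂ δ₂ g‖₂ ≤ L * sobNorm 1 (f - g) := by
  have hfreq := continuous_freq
  obtain ⟨C₁, hC₁, h₁⟩ := exists_bound_smul
    (p := b * (freq * fun ξ => 1 - γ₂ * freq ξ ^ 2 + δ₂ * freq ξ ^ 4)) (by fun_prop) hbc.mul_right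
  obtain ⟨C₂, h₂⟩ := exists_bound_smul_of_norm_le (hb.mul hfreq) hbc.mul_right
  refine ⟨C₁ + nonlinLip γ B * C₂, fun f g hf hg hfB hgB => ?_⟩
  have hd := hf.sub hg
  have hI : ‖-Complex.I‖₊ = 1 := by simp
  have hN : AEStronglyMeasurable ((-Complex.I) • (nonlin γ f - nonlin γ g)) :=
    ((aestronglyMeasurable_nonlin hf).sub (aestronglyMeasurable_nonlin hg)).const_smul _
  have hNle : ∀ ξ, ‖((-Complex.I) • (nonlin γ f - nonlin γ g)) ξ‖
      ≤ bracket ξ ^ 2 * (nonlinLip γ B * sobNorm 1 (f - g)) := fun ξ => by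
    rw [Pi.smul_apply, norm_smul, norm_neg, Complex.norm_I, one_mul]
    exact norm_nonlin_sub_le hf hg hfB hgB ξ
  obtain ⟨m₁, le₁⟩ := h₁ _ (hd.memLp.const_smul (-Complex.I))
  obtain ⟨m₂, le₂⟩ := h₂ _ _ hN hNle
  rw [lpNorm_const_smul, hI, NNReal.coe_one, one_mul] at le₁
  rw [smul_rhs_sub]
  refine ⟨m₁.add m₂, (lpNorm_add_le m₁ one_le_two).trans ?_⟩
  calc _ ≤ C₁ * sobNorm 1 (f - g) + nonlinLip γ B * sobNorm 1 (f - g) * C₂ :=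
        add_le_add (le₁.trans (mul_le_mul_of_nonneg_left (lpNorm_le_sobNorm hd) hC₁)) le₂
    _ = (C₁ + nonlinLip γ B * C₂) * sobNorm 1 (f - g) := by ring

theorem rhs_zero : rhs γ γ₂ δ₂ 0 = 0 := by
  funext ξ
  simp [rhs, nonlin, quadPart, conv]

theorem memSob_zero_fun {s : ℕ} : MemSob s 0 := by
  rw [MemSob, smul_zero]
  exact MemLp.zero

theorem memLp_smul_rhs (γ γ₂ δ₂ : ℝ) (hb : Continuous b) (hbc : HasCompactSupport b)
    (hg : MemSob 1 g) : MemLp (b • rhs γ γ₂ δ₂ g) 2 := by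
  obtain ⟨L, hL⟩ := exists_lipschitz_smul_rhs γ γ₂ δ₂ (sobNorm 1 g) hb hbc
  have h0 : sobNorm 1 0 ≤ sobNorm 1 g := by
    rw [sobNorm, smul_zero, lpNorm_zero]
    exact sobNorm_nonneg
  have h := (hL g 0 hg memSob_zero_fun le_rfl h0).1
  rwa [rhs_zero, smul_zero, sub_zero] at h

end Truncation

/-! ### The elliptic symbol -/

/-- The ellipticity constant of the symbol `1 + γ₁ k² + δ₁ k⁴` relative to `(1 + k²)²`. -/
def ellConst (γ₁ δ₁ : ℝ) : ℝ := min 1 (min (γ₁ / 2) δ₁)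

section symb

variable {γ₁ δ₁ : ℝ}

theorem ellConst_pos (hγ₁ : 0 < γ₁) (hδ₁ : 0 < δ₁) : 0 < ellConst γ₁ δ₁ :=
  lt_min one_pos (lt_min (half_pos hγ₁) hδ₁)

theorem ellConst_mul_le_symb (γ₁ δ₁ ξ : ℝ) :
    ellConst γ₁ δ₁ * (bracket ξ ^ 2) ^ 2 ≤ symb γ₁ δ₁ ξ := by
  have h₁ : ellConst γ₁ δ₁ ≤ 1 := min_le_left _ _
  have h₂ : ellConst γ₁ δ₁ ≤ γ₁ / 2 := (min_le_right _ _).trans (min_le_left _ _)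
  have h₃ : ellConst γ₁ δ₁ ≤ δ₁ := (min_le_right _ _).trans (min_le_right _ _)
  rw [symb, sq_bracket]
  calc ellConst γ₁ δ₁ * (1 + freq ξ ^ 2) ^ 2
      = ellConst γ₁ δ₁ + 2 * ellConst γ₁ δ₁ * freq ξ ^ 2 + ellConst γ₁ δ₁ * freq ξ ^ 4 := by ring
    _ ≤ 1 + γ₁ * freq ξ ^ 2 + δ₁ * freq ξ ^ 4 := by
        gcongr
        linarith

theorem symb_le (hγ₁ : 0 ≤ γ₁) (hδ₁ : 0 ≤ δ₁) (ξ : ℝ) :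
    symb γ₁ δ₁ ξ ≤ (1 + γ₁ + δ₁) * (bracket ξ ^ 2) ^ 2 := by
  have h : (1 + γ₁ + δ₁) * (1 + freq ξ ^ 2) ^ 2 - symb γ₁ δ₁ ξ
      = γ₁ + δ₁ + (2 + γ₁ + 2 * δ₁) * freq ξ ^ 2 + (1 + γ₁) * freq ξ ^ 4 := by
    rw [symb]
    ring
  rw [sq_bracket, ← sub_nonneg, h]
  positivity

theorem symb_pos (hγ₁ : 0 ≤ γ₁) (hδ₁ : 0 ≤ δ₁) (ξ : ℝ) : 0 < symb γ₁ δ₁ ξ := by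
  unfold symb
  positivity

theorem contDiff_symb (γ₁ δ₁ : ℝ) : ContDiff ℝ ∞ (symb γ₁ δ₁) := by
  unfold symb freq
  fun_prop

end symb

/-! ### The truncated flow in `L²` -/

open Classical in
/-- The class in `L²` of a square-integrable function, and `0` for other functions. -/
def toL2 (f : ℝ → ℂ) : Lp ℂ 2 (volume : Measure ℝ) :=
  if h : MemLp f 2 then h.toLp f else 0

section toL2

variable {f g : ℝ → ℂ}

theorem coeFn_toL2 (hf : MemLp f 2) : toL2 f =ᵐ[volume] f := by
  rw [toL2, dif_pos hf]
  exact hf.coeFn_toLp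

theorem norm_toL2 (hf : MemLp f 2) : ‖toL2 f‖ = ‖f‖₂ := by
  rw [toL2, dif_pos hf, Lp.norm_toLp, toReal_eLpNorm hf.1]

theorem toL2_sub (hf : MemLp f 2) (hg : MemLp g 2) : toL2 (f - g) = toL2 f - toL2 g := by
  rw [toL2, toL2, toL2, dif_pos hf, dif_pos hg, dif_pos (hf.sub hg), MemLp.toLp_sub]

theorem inner_toL2 {d : Lp ℂ 2 (volume : Measure ℝ)} (hd : d =ᵐ[volume] f) (hg : MemLp g 2) :
    inner ℂ d (toL2 g) = ∫ ξ, conj (f ξ) * g ξ := by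
  rw [L2.inner_def]
  refine integral_congr_ae ?_
  filter_upwards [hd, coeFn_toL2 hg] with ξ h₁ h₂
  rw [h₁, h₂, RCLike.inner_apply']

end toL2

/-- A solution `t ↦ g t` of the equation on the Fourier side, with `cosh(σ|D|)`-weighted `H²`
regularity. -/
structure FourierSolution (σ γ γ₁ γ₂ δ₁ δ₂ T : ℝ) (g : ℝ → ℝ → ℂ) : Prop where
  mem : ∀ t ∈ Icc 0 T, MemSob 2 (coshSymbol σ • g t)
  tendsto : ∀ t ∈ Icc 0 T,
    Tendsto (fun r => sobNorm 2 (coshSymbol σ • (g r - g t))) (𝓝[Icc 0 T] t) (𝓝 0)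
  herm : ∀ t ∈ Icc 0 T, ∀ᵐ ξ, g t (-ξ) = conj (g t ξ)
  hasDeriv : ∀ θ : 𝓢(ℝ, ℂ), ∀ t ∈ Icc 0 T,
    HasDerivWithinAt (fun r => ∫ ξ, g r ξ * (symb γ₁ δ₁ ξ * θ ξ))
      (∫ ξ, rhs γ γ₂ δ₂ (g t) ξ * θ ξ) (Icc 0 T) t

theorem bracket_pow_mul_norm_le_coshSymbol_smul {s t : ℕ} (hst : s ≤ t) (σ : ℝ) (f : ℝ → ℂ)
    (ξ : ℝ) : bracket ξ ^ s * ‖f ξ‖ ≤ 1 * (bracket ξ ^ t * ‖(coshSymbol σ • f) ξ‖) := by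
  rw [Pi.smul_apply', norm_smul, Real.norm_of_nonneg (coshSymbol_pos σ ξ).le, one_mul]
  have hb := one_le_bracket ξ
  gcongr
  exact le_mul_of_one_le_left (norm_nonneg _) (Real.one_le_cosh _)

theorem MemSob.of_coshSymbol_smul {s t : ℕ} {σ : ℝ} {f : ℝ → ℂ}
    (hf : MemSob t (coshSymbol σ • f)) (hst : s ≤ t) : MemSob s f :=
  hf.of_norm_le (aestronglyMeasurable_of_smul (continuous_coshSymbol σ)
    (fun ξ => (coshSymbol_pos σ ξ).ne') hf.aestronglyMeasurable)
    (bracket_pow_mul_norm_le_coshSymbol_smul hst σ f)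

theorem sobNorm_le_sobNorm_coshSymbol_smul {s t : ℕ} {σ : ℝ} {f : ℝ → ℂ}
    (hf : MemSob t (coshSymbol σ • f)) (hst : s ≤ t) :
    sobNorm s f ≤ sobNorm t (coshSymbol σ • f) := by
  simpa using sobNorm_le_of_norm_le hf (bracket_pow_mul_norm_le_coshSymbol_smul hst σ f)

namespace FourierSolution

variable {σ γ γ₁ γ₂ δ₁ δ₂ T t : ℝ} {g : ℝ → ℝ → ℂ} {b : ℝ → ℝ}

theorem mem_sub {r : ℝ} (S : FourierSolution σ γ γ₁ γ₂ δ₁ δ₂ T g) (hr : r ∈ Icc 0 T)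
    (ht : t ∈ Icc 0 T) : MemSob 2 (coshSymbol σ • (g r - g t)) := by
  rw [smul_sub]
  exact (S.mem r hr).sub (S.mem t ht)

theorem memSob (S : FourierSolution σ γ γ₁ γ₂ δ₁ δ₂ T g) (ht : t ∈ Icc 0 T) : MemSob 1 (g t) :=
  (S.mem t ht).of_coshSymbol_smul one_le_two

theorem continuousOn_sobNorm (S : FourierSolution σ γ γ₁ γ₂ δ₁ δ₂ T g) :
    ContinuousOn (fun t => sobNorm 2 (coshSymbol σ • g t)) (Icc 0 T) := fun t ht => by
  rw [ContinuousWithinAt, tendsto_iff_dist_tendsto_zero]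
  refine squeeze_zero' (.of_forall fun r => dist_nonneg) ?_ (S.tendsto t ht)
  filter_upwards [self_mem_nhdsWithin] with r hr
  rw [sobNorm, sobNorm, sobNorm, smul_sub, smul_sub, ← norm_toL2 (S.mem r hr),
    ← norm_toL2 (S.mem t ht), ← norm_toL2 (MemLp.sub (S.mem r hr) (S.mem t ht)),
    toL2_sub (S.mem r hr) (S.mem t ht)]
  exact abs_norm_sub_norm_le _ _

theorem exists_sobNorm_le (S : FourierSolution σ γ γ₁ γ₂ δ₁ δ₂ T g) :
    ∃ B, ∀ t ∈ Icc 0 T, sobNorm 2 (coshSymbol σ • g t) ≤ B := by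
  obtain ⟨B, hB⟩ := isCompact_Icc.exists_bound_of_continuousOn S.continuousOn_sobNorm
  exact ⟨B, fun t ht => (le_abs_self _).trans (hB t ht)⟩

theorem continuousOn_toL2_smul_rhs (S : FourierSolution σ γ γ₁ γ₂ δ₁ δ₂ T g) (hb : Continuous b)
    (hbc : HasCompactSupport b) :
    ContinuousOn (fun t => toL2 (b • rhs γ γ₂ δ₂ (g t))) (Icc 0 T) := fun t ht => by
  obtain ⟨B, hB⟩ := S.exists_sobNorm_le
  have hB₁ : ∀ r ∈ Icc 0 T, sobNorm 1 (g r) ≤ B := fun r hr =>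
    (sobNorm_le_sobNorm_coshSymbol_smul (S.mem r hr) one_le_two).trans (hB r hr)
  obtain ⟨L, hL⟩ := exists_lipschitz_smul_rhs γ γ₂ δ₂ B hb hbc
  rw [ContinuousWithinAt, tendsto_iff_norm_sub_tendsto_zero]
  have hlim := (S.tendsto t ht).const_mul |L|
  rw [mul_zero] at hlim
  refine squeeze_zero' (.of_forall fun r => norm_nonneg _) ?_ hlim
  filter_upwards [self_mem_nhdsWithin] with r hr
  obtain ⟨hmem, hle⟩ := hL _ _ (S.memSob hr) (S.memSob ht) (hB₁ r hr) (hB₁ t ht)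
  rw [← toL2_sub (memLp_smul_rhs γ γ₂ δ₂ hb hbc (S.memSob hr))
    (memLp_smul_rhs γ γ₂ δ₂ hb hbc (S.memSob ht)), norm_toL2 hmem]
  exact hle.trans (mul_le_mul (le_abs_self L)
    (sobNorm_le_sobNorm_coshSymbol_smul (S.mem_sub hr ht) one_le_two) sobNorm_nonneg
    (abs_nonneg L))

theorem memLp_mul_symb_smul {f : ℝ → ℂ} (hb : Continuous b) (hbc : HasCompactSupport b)
    (hf : MemLp f 2) : MemLp ((b * symb γ₁ δ₁) • f) 2 := by
  obtain ⟨C, -, h⟩ := exists_bound_smul (hb.mul (contDiff_symb γ₁ δ₁).continuous) hbc.mul_right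
  exact (h f hf).1

theorem hasDerivWithinAt_toL2 (S : FourierSolution σ γ γ₁ γ₂ δ₁ δ₂ T g) (hb : ContDiff ℝ ∞ b)
    (hbc : HasCompactSupport b) (ht : t ∈ Icc 0 T) :
    HasDerivWithinAt (fun r => toL2 ((b * symb γ₁ δ₁) • g r))
      (toL2 (b • rhs γ γ₂ δ₂ (g t))) (Icc 0 T) t := by
  refine hasDerivWithinAt_of_inner (v := fun t => toL2 (b • rhs γ γ₂ δ₂ (g t)))
    (Lp.dense_hasCompactSupport_contDiff (F := ℂ) (μ := (volume : Measure ℝ)) (p := 2)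
      (by norm_num)) (S.continuousOn_toL2_smul_rhs hb.continuous hbc) ?_ ht
  rintro d ⟨k, hdk, hkc, hks⟩ s hs
  have hθc : HasCompactSupport fun ξ => (b ξ : ℂ) * conj (k ξ) :=
    (hkc.comp_left (g := conj) (map_zero _)).mul_left
  have hθ : ContDiff ℝ ∞ fun ξ => (b ξ : ℂ) * conj (k ξ) :=
    (Complex.ofRealCLM.contDiff.comp hb).mul (Complex.conjCLE.contDiff.comp hks)
  have hstate : ∀ r ∈ Icc 0 T, inner ℂ d (toL2 ((b * symb γ₁ δ₁) • g r))
      = ∫ ξ, g r ξ * (symb γ₁ δ₁ ξ * (b ξ * conj (k ξ))) := fun r hr => by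
    rw [inner_toL2 hdk (memLp_mul_symb_smul hb.continuous hbc (S.memSob hr).memLp)]
    refine integral_congr_ae (ae_of_all _ fun ξ => ?_)
    simp only [Pi.smul_apply', Pi.mul_apply, Complex.real_smul, Complex.ofReal_mul]
    ring
  have hrhs : inner ℂ d (toL2 (b • rhs γ γ₂ δ₂ (g s)))
      = ∫ ξ, rhs γ γ₂ δ₂ (g s) ξ * (b ξ * conj (k ξ)) := by
    rw [inner_toL2 hdk (memLp_smul_rhs γ γ₂ δ₂ hb.continuous hbc (S.memSob hs))]
    refine integral_congr_ae (ae_of_all _ fun ξ => ?_)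
    simp only [Pi.smul_apply', Complex.real_smul]
    ring
  rw [hrhs]
  exact (S.hasDeriv (hθc.toSchwartzMap hθ) s hs).congr hstate (hstate s hs)

end FourierSolution

/-! ### The energy balance -/

/-- The modified energy as a function of the Fourier transform. -/
def fourierEnergy (γ₁ δ₁ σ : ℝ) (g : ℝ → ℂ) : ℝ :=
  (1 / 2) * ∫ ξ, symb γ₁ δ₁ ξ * ‖(coshSymbol σ • g) ξ‖ ^ 2

/-- The weight `b` with `b² symb = χ² cosh²`, for a cutoff function `χ`. The truncated energy is
the square of the `L²` norm of `b * symb • g`. -/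
def cutoffWeight (σ γ₁ δ₁ : ℝ) (χ : ℝ → ℝ) (ξ : ℝ) : ℝ :=
  χ ξ * (coshSymbol σ ξ * (√(symb γ₁ δ₁ ξ))⁻¹)

section Energy

variable {σ γ γ₁ γ₂ δ₁ δ₂ : ℝ} {a g : ℝ → ℂ} {χ : ℝ → ℝ}

theorem sq_norm_bracket_sq_smul (a : ℝ → ℂ) (ξ : ℝ) :
    ‖(bracket ^ 2 • a) ξ‖ ^ 2 = (bracket ξ ^ 2) ^ 2 * ‖a ξ‖ ^ 2 := by
  rw [norm_bracket_pow_smul, mul_pow]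

theorem MemSob.integrable_symb_mul_sq (hγ₁ : 0 ≤ γ₁) (hδ₁ : 0 ≤ δ₁) (ha : MemSob 2 a) :
    Integrable fun ξ => symb γ₁ δ₁ ξ * ‖a ξ‖ ^ 2 := by
  refine ((MemLp.integrable_norm_pow ha two_ne_zero).const_mul (1 + γ₁ + δ₁)).mono'
    ((contDiff_symb γ₁ δ₁).continuous.aestronglyMeasurable.mul
      (ha.aestronglyMeasurable.norm.pow 2)) (ae_of_all _ fun ξ => ?_)
  have hs := symb_pos hγ₁ hδ₁ ξ
  rw [Real.norm_of_nonneg (by positivity), sq_norm_bracket_sq_smul, ← mul_assoc]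
  gcongr
  exact symb_le hγ₁ hδ₁ ξ

theorem ellConst_mul_sq_sobNorm_le (hγ₁ : 0 ≤ γ₁) (hδ₁ : 0 ≤ δ₁)
    (ha : MemSob 2 (coshSymbol σ • g)) :
    ellConst γ₁ δ₁ / 2 * sobNorm 2 (coshSymbol σ • g) ^ 2 ≤ fourierEnergy γ₁ δ₁ σ g := by
  rw [sobNorm, sq_lpNorm_two ha, fourierEnergy, one_div_mul_eq_div, div_mul_eq_mul_div,
    ← integral_const_mul]
  gcongr
  · exact (MemLp.integrable_norm_pow ha two_ne_zero).const_mul _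
  · exact ha.integrable_symb_mul_sq hγ₁ hδ₁
  · intro ξ
    simp only [sq_norm_bracket_sq_smul, ← mul_assoc]
    gcongr
    exact ellConst_mul_le_symb γ₁ δ₁ ξ

theorem fourierEnergy_le (hγ₁ : 0 ≤ γ₁) (hδ₁ : 0 ≤ δ₁) (ha : MemSob 2 (coshSymbol σ • g)) :
    fourierEnergy γ₁ δ₁ σ g ≤ (1 + γ₁ + δ₁) / 2 * sobNorm 2 (coshSymbol σ • g) ^ 2 := by
  rw [sobNorm, sq_lpNorm_two ha, fourierEnergy, one_div_mul_eq_div, div_mul_eq_mul_div,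
    ← integral_const_mul]
  gcongr
  · exact ha.integrable_symb_mul_sq hγ₁ hδ₁
  · exact (MemLp.integrable_norm_pow ha two_ne_zero).const_mul _
  · intro ξ
    simp only [sq_norm_bracket_sq_smul, ← mul_assoc]
    gcongr
    exact symb_le hγ₁ hδ₁ ξ

theorem contDiff_cutoffWeight (hγ₁ : 0 ≤ γ₁) (hδ₁ : 0 ≤ δ₁) (hχ : ContDiff ℝ ∞ χ) (σ : ℝ) :
    ContDiff ℝ ∞ (cutoffWeight σ γ₁ δ₁ χ) := by
  have hcosh : ContDiff ℝ ∞ (coshSymbol σ) := by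
    unfold coshSymbol freq
    fun_prop
  have hsqrt : ContDiff ℝ ∞ fun ξ => √(symb γ₁ δ₁ ξ) :=
    (contDiff_symb γ₁ δ₁).sqrt fun ξ => (symb_pos hγ₁ hδ₁ ξ).ne'
  exact hχ.mul (hcosh.mul (hsqrt.inv fun ξ => (Real.sqrt_pos.2 (symb_pos hγ₁ hδ₁ ξ)).ne'))

theorem sq_cutoffWeight_mul_symb (hγ₁ : 0 ≤ γ₁) (hδ₁ : 0 ≤ δ₁) (ξ : ℝ) :
    cutoffWeight σ γ₁ δ₁ χ ξ ^ 2 * symb γ₁ δ₁ ξ = χ ξ ^ 2 * coshSymbol σ ξ ^ 2 := by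
  have hs := symb_pos hγ₁ hδ₁ ξ
  rw [cutoffWeight, mul_pow, mul_pow, inv_pow, Real.sq_sqrt hs.le]
  field_simp

theorem sq_norm_cutoffWeight_mul_symb_smul (hγ₁ : 0 ≤ γ₁) (hδ₁ : 0 ≤ δ₁) (ξ : ℝ) :
    ‖((cutoffWeight σ γ₁ δ₁ χ * symb γ₁ δ₁) • g) ξ‖ ^ 2
      = χ ξ ^ 2 * (symb γ₁ δ₁ ξ * ‖(coshSymbol σ • g) ξ‖ ^ 2) := by
  have h := sq_cutoffWeight_mul_symb (σ := σ) (χ := χ) hγ₁ hδ₁ ξ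
  simp only [Pi.smul_apply', Pi.mul_apply, norm_smul, mul_pow, Real.norm_eq_abs, sq_abs]
  linear_combination symb γ₁ δ₁ ξ * ‖g ξ‖ ^ 2 * h

-- The linear terms of the equation only contribute to the imaginary part.
theorem re_conj_mul_rhs_eq_re_flux (hγ₁ : 0 ≤ γ₁) (hδ₁ : 0 ≤ δ₁) (ξ : ℝ) :
    (conj (((cutoffWeight σ γ₁ δ₁ χ * symb γ₁ δ₁) • g) ξ)
      * (cutoffWeight σ γ₁ δ₁ χ • rhs γ γ₂ δ₂ g) ξ).re = χ ξ ^ 2 * (flux σ γ g ξ).re := by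
  have hw : ((cutoffWeight σ γ₁ δ₁ χ ξ : ℂ)) ^ 2 * symb γ₁ δ₁ ξ
      = (χ ξ : ℂ) ^ 2 * (coshSymbol σ ξ : ℂ) ^ 2 :=
    mod_cast sq_cutoffWeight_mul_symb hγ₁ hδ₁ ξ
  have h : conj (((cutoffWeight σ γ₁ δ₁ χ * symb γ₁ δ₁) • g) ξ)
      * (cutoffWeight σ γ₁ δ₁ χ • rhs γ γ₂ δ₂ g) ξ
      = ((χ ξ ^ 2 : ℝ) : ℂ) * flux σ γ g ξ
        + ((-(χ ξ ^ 2 * coshSymbol σ ξ ^ 2 * freq ξ * (1 - γ₂ * freq ξ ^ 2 + δ₂ * freq ξ ^ 4)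
          * Complex.normSq (g ξ)) : ℝ) : ℂ) * Complex.I := by
    simp only [flux, rhs, Pi.smul_apply', Pi.mul_apply, Complex.real_smul, map_mul,
      Complex.conj_ofReal, Complex.ofReal_mul, Complex.ofReal_neg, Complex.ofReal_pow,
      Complex.normSq_eq_conj_mul_self]
    linear_combination (conj (g ξ) * -Complex.I * freq ξ
      * (((1 - γ₂ * freq ξ ^ 2 + δ₂ * freq ξ ^ 4 : ℝ) : ℂ) * g ξ + nonlin γ g ξ)) * hw
  rw [h, Complex.add_re, Complex.re_ofReal_mul, Complex.re_ofReal_mul, Complex.I_re, mul_zero,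
    add_zero]

end Energy

namespace FourierSolution

variable {σ γ γ₁ γ₂ δ₁ δ₂ T t : ℝ} {g : ℝ → ℝ → ℂ} {χ : ℝ → ℝ}

theorem re_inner_toL2 (S : FourierSolution σ γ γ₁ γ₂ δ₁ δ₂ T g) (hγ₁ : 0 ≤ γ₁) (hδ₁ : 0 ≤ δ₁)
    (hχ : ContDiff ℝ ∞ χ) (hχc : HasCompactSupport χ) (ht : t ∈ Icc 0 T) :
    (inner ℂ (toL2 ((cutoffWeight σ γ₁ δ₁ χ * symb γ₁ δ₁) • g t))
      (toL2 (cutoffWeight σ γ₁ δ₁ χ • rhs γ γ₂ δ₂ (g t)))).re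
      = ∫ ξ, χ ξ ^ 2 * (flux σ γ (g t) ξ).re := by
  have hb := (contDiff_cutoffWeight hγ₁ hδ₁ hχ σ).continuous
  have hbc : HasCompactSupport (cutoffWeight σ γ₁ δ₁ χ) := hχc.mul_right
  have hu : MemLp ((cutoffWeight σ γ₁ δ₁ χ * symb γ₁ δ₁) • g t) 2 :=
    memLp_mul_symb_smul hb hbc (S.memSob ht).memLp
  have hv := memLp_smul_rhs γ γ₂ δ₂ hb hbc (S.memSob ht)
  rw [inner_toL2 (coeFn_toL2 hu) hv]
  exact (integral_re (hu.star.integrable_mul hv)).symm.trans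
    (integral_congr_ae (ae_of_all _ fun ξ => re_conj_mul_rhs_eq_re_flux hγ₁ hδ₁ ξ))

theorem hasDerivWithinAt_sq_norm_toL2 (S : FourierSolution σ γ γ₁ γ₂ δ₁ δ₂ T g) (hγ₁ : 0 ≤ γ₁)
    (hδ₁ : 0 ≤ δ₁) (hχ : ContDiff ℝ ∞ χ) (hχc : HasCompactSupport χ) (ht : t ∈ Icc 0 T) :
    HasDerivWithinAt (fun r => ‖toL2 ((cutoffWeight σ γ₁ δ₁ χ * symb γ₁ δ₁) • g r)‖ ^ 2)
      (2 * ∫ ξ, χ ξ ^ 2 * (flux σ γ (g t) ξ).re) (Icc 0 T) t := by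
  have h := S.hasDerivWithinAt_toL2 (contDiff_cutoffWeight hγ₁ hδ₁ hχ σ) hχc.mul_right ht
  have hre := Complex.reCLM.hasFDerivAt.comp_hasDerivWithinAt t (h.inner ℂ h)
  have hsq : (fun r => ‖toL2 ((cutoffWeight σ γ₁ δ₁ χ * symb γ₁ δ₁) • g r)‖ ^ 2)
      = Complex.reCLM ∘ fun r => inner ℂ (toL2 ((cutoffWeight σ γ₁ δ₁ χ * symb γ₁ δ₁) • g r))
        (toL2 ((cutoffWeight σ γ₁ δ₁ χ * symb γ₁ δ₁) • g r)) :=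
    funext fun r => (inner_self_eq_norm_sq (𝕜 := ℂ) _).symm
  rw [hsq]
  refine hre.congr_deriv ?_
  rw [Complex.reCLM_apply, Complex.add_re, ← S.re_inner_toL2 hγ₁ hδ₁ hχ hχc ht, two_mul]
  exact congrArg _ (inner_re_symm (𝕜 := ℂ) _ _)

theorem continuousOn_integral_cutoff_flux (S : FourierSolution σ γ γ₁ γ₂ δ₁ δ₂ T g)
    (hγ₁ : 0 ≤ γ₁) (hδ₁ : 0 ≤ δ₁) (hχ : ContDiff ℝ ∞ χ) (hχc : HasCompactSupport χ) :
    ContinuousOn (fun t => ∫ ξ, χ ξ ^ 2 * (flux σ γ (g t) ξ).re) (Icc 0 T) := by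
  have hb := contDiff_cutoffWeight hγ₁ hδ₁ hχ σ
  have hstate := fun t ht =>
    (S.hasDerivWithinAt_toL2 hb hχc.mul_right (t := t) ht).continuousWithinAt
  have hrhs := S.continuousOn_toL2_smul_rhs hb.continuous hχc.mul_right
  exact (Complex.continuous_re.comp_continuousOn (ContinuousOn.inner (𝕜 := ℂ) hstate hrhs)).congr
    fun t ht => (S.re_inner_toL2 hγ₁ hδ₁ hχ hχc ht).symm

theorem integral_cutoff_energy_sub (S : FourierSolution σ γ γ₁ γ₂ δ₁ δ₂ T g) (hγ₁ : 0 ≤ γ₁)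
    (hδ₁ : 0 ≤ δ₁) (hχ : ContDiff ℝ ∞ χ) (hχc : HasCompactSupport χ) (ht : t ∈ Icc 0 T) :
    (∫ ξ, χ ξ ^ 2 * (symb γ₁ δ₁ ξ * ‖(coshSymbol σ • g t) ξ‖ ^ 2))
      - ∫ ξ, χ ξ ^ 2 * (symb γ₁ δ₁ ξ * ‖(coshSymbol σ • g 0) ξ‖ ^ 2)
      = 2 * ∫ r in (0 : ℝ)..t, ∫ ξ, χ ξ ^ 2 * (flux σ γ (g r) ξ).re := by
  have hsub : Icc 0 t ⊆ Icc 0 T := Icc_subset_Icc_right ht.2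
  have hnorm : ∀ r ∈ Icc 0 T, ‖toL2 ((cutoffWeight σ γ₁ δ₁ χ * symb γ₁ δ₁) • g r)‖ ^ 2
      = ∫ ξ, χ ξ ^ 2 * (symb γ₁ δ₁ ξ * ‖(coshSymbol σ • g r) ξ‖ ^ 2) := fun r hr => by
    have hmem : MemLp ((cutoffWeight σ γ₁ δ₁ χ * symb γ₁ δ₁) • g r) 2 :=
      memLp_mul_symb_smul (contDiff_cutoffWeight hγ₁ hδ₁ hχ σ).continuous hχc.mul_right
        (S.memSob hr).memLp
    simp only [norm_toL2 hmem, sq_lpNorm_two hmem, sq_norm_cutoffWeight_mul_symb_smul hγ₁ hδ₁]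
  have hderiv := fun r hr => S.hasDerivWithinAt_sq_norm_toL2 hγ₁ hδ₁ hχ hχc (t := r) hr
  rw [← hnorm t ht, ← hnorm 0 ⟨le_rfl, ht.1.trans ht.2⟩, ← intervalIntegral.integral_const_mul]
  refine (intervalIntegral.integral_eq_sub_of_hasDerivAt_of_le ht.1
    (fun r hr => (hderiv r (hsub hr)).continuousWithinAt.mono hsub) (fun r hr => ?_) ?_).symm
  · exact (hderiv r (hsub (Ioo_subset_Icc_self hr))).hasDerivAt
      (Icc_mem_nhds hr.1 (hr.2.trans_le ht.2))
  · refine ContinuousOn.intervalIntegrable ?_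
    rw [uIcc_of_le ht.1]
    exact ((S.continuousOn_integral_cutoff_flux hγ₁ hδ₁ hχ hχc).mono hsub).const_mul 2

end FourierSolution

/-- Smooth cutoff functions exhausting the line. -/
def cutoff (n : ℕ) : ContDiffBump (0 : ℝ) where
  rIn := n + 1
  rOut := n + 2
  rIn_pos := by positivity
  rIn_lt_rOut := by linarith

theorem tendsto_cutoff (ξ : ℝ) : Tendsto (fun n => cutoff n ξ) atTop (𝓝 1) := by
  refine tendsto_const_nhds.congr' ?_
  filter_upwards [eventually_ge_atTop ⌈|ξ|⌉₊] with n hn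
  refine ((cutoff n).one_of_mem_closedBall ?_).symm
  rw [mem_closedBall_zero_iff, Real.norm_eq_abs]
  exact (Nat.le_of_ceil_le hn).trans (lt_add_one _).le

theorem norm_sq_cutoff_mul_le (n : ℕ) (ξ x : ℝ) : ‖cutoff n ξ ^ 2 * x‖ ≤ ‖x‖ := by
  rw [norm_mul, norm_pow, Real.norm_of_nonneg (cutoff n).nonneg]
  exact mul_le_of_le_one_left (norm_nonneg _) (pow_le_one₀ (cutoff n).nonneg (cutoff n).le_one)

theorem tendsto_integral_sq_cutoff_mul {f : ℝ → ℝ} (hf : Integrable f) :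
    Tendsto (fun n => ∫ ξ, cutoff n ξ ^ 2 * f ξ) atTop (𝓝 (∫ ξ, f ξ)) := by
  refine tendsto_integral_of_dominated_convergence (fun ξ => ‖f ξ‖) (fun n => ?_) hf.norm
    (fun n => ae_of_all _ fun ξ => norm_sq_cutoff_mul_le n ξ (f ξ)) (ae_of_all _ fun ξ => ?_)
  · exact ((cutoff n).continuous.pow 2).aestronglyMeasurable.mul hf.1
  · simpa only [one_pow, one_mul] using ((tendsto_cutoff ξ).pow 2).mul_const (f ξ)

namespace FourierSolution

variable {σ γ γ₁ γ₂ δ₁ δ₂ T t : ℝ} {g : ℝ → ℝ → ℂ}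

theorem hasL1Bound_flux (S : FourierSolution σ γ γ₁ γ₂ δ₁ δ₂ T g) (hσ : 0 ≤ σ)
    (ht : t ∈ Icc 0 T) :
    HasL1Bound (flux σ γ (g t)) (2 * fluxConst γ
      * ((1 + sobNorm 2 (coshSymbol σ • g t)) * sobNorm 2 (coshSymbol σ • g t) ^ 3)) :=
  KdVBBM.hasL1Bound_flux hσ (S.mem t ht) (S.herm t ht)

theorem tendsto_integral_cutoff_flux (S : FourierSolution σ γ γ₁ γ₂ δ₁ δ₂ T g) (hσ : 0 ≤ σ)
    (hγ₁ : 0 ≤ γ₁) (hδ₁ : 0 ≤ δ₁) (ht : t ∈ Icc 0 T) :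
    Tendsto (fun n => ∫ r in (0 : ℝ)..t, ∫ ξ, cutoff n ξ ^ 2 * (flux σ γ (g r) ξ).re) atTop
      (𝓝 (∫ r in (0 : ℝ)..t, ∫ ξ, (flux σ γ (g r) ξ).re)) := by
  obtain ⟨B, hB⟩ := S.exists_sobNorm_le
  have hsub : uIoc 0 t ⊆ Icc 0 T := by
    rw [uIoc_of_le ht.1]
    exact Ioc_subset_Icc_self.trans (Icc_subset_Icc_right ht.2)
  refine intervalIntegral.tendsto_integral_filter_of_dominated_convergence
    (fun _ => 2 * fluxConst γ * ((1 + B) * B ^ 3)) (.of_forall fun n => ?_)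
    (.of_forall fun n => ae_of_all _ fun r hr => ?_) intervalIntegrable_const
    (ae_of_all _ fun r hr => tendsto_integral_sq_cutoff_mul
      (S.hasL1Bound_flux hσ (hsub hr)).integrable.re)
  · exact ((S.continuousOn_integral_cutoff_flux hγ₁ hδ₁ (cutoff n).contDiff
      (cutoff n).hasCompactSupport).mono hsub).aestronglyMeasurable measurableSet_uIoc
  · have hflux := S.hasL1Bound_flux hσ (hsub hr)
    have hX := hB r (hsub hr)
    have hX₀ := sobNorm_nonneg (s := 2) (f := coshSymbol σ • g r)
    have hB₀ := hX₀.trans hX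
    have hC := fluxConst_nonneg γ
    calc ‖∫ ξ, cutoff n ξ ^ 2 * (flux σ γ (g r) ξ).re‖
        ≤ ∫ ξ, ‖flux σ γ (g r) ξ‖ :=
          norm_integral_le_of_norm_le hflux.integrable.norm (ae_of_all _ fun ξ =>
            (norm_sq_cutoff_mul_le n ξ _).trans (Complex.abs_re_le_norm _))
      _ ≤ _ := hflux.integral_norm_le
      _ ≤ 2 * fluxConst γ * ((1 + B) * B ^ 3) := by gcongr

theorem fourierEnergy_sub (S : FourierSolution σ γ γ₁ γ₂ δ₁ δ₂ T g) (hσ : 0 ≤ σ) (hγ₁ : 0 ≤ γ₁)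
    (hδ₁ : 0 ≤ δ₁) (ht : t ∈ Icc 0 T) :
    fourierEnergy γ₁ δ₁ σ (g t) - fourierEnergy γ₁ δ₁ σ (g 0)
      = ∫ r in (0 : ℝ)..t, ∫ ξ, (flux σ γ (g r) ξ).re := by
  have henergy : ∀ r ∈ Icc 0 T, Tendsto
      (fun n => ∫ ξ, cutoff n ξ ^ 2 * (symb γ₁ δ₁ ξ * ‖(coshSymbol σ • g r) ξ‖ ^ 2)) atTop
      (𝓝 (∫ ξ, symb γ₁ δ₁ ξ * ‖(coshSymbol σ • g r) ξ‖ ^ 2)) := fun r hr =>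
    tendsto_integral_sq_cutoff_mul ((S.mem r hr).integrable_symb_mul_sq hγ₁ hδ₁)
  have hlim := tendsto_nhds_unique
    ((henergy t ht).sub (henergy 0 ⟨le_rfl, ht.1.trans ht.2⟩))
    (((S.tendsto_integral_cutoff_flux hσ hγ₁ hδ₁ ht).const_mul 2).congr fun n =>
      (S.integral_cutoff_energy_sub hγ₁ hδ₁ (cutoff n).contDiff (cutoff n).hasCompactSupport
        ht).symm)
  rw [fourierEnergy, fourierEnergy, ← mul_sub, hlim]
  ring

theorem abs_fourierEnergy_sub_le (S : FourierSolution σ (7 / 48) γ₁ γ₂ δ₁ δ₂ T g) (hσ : 0 ≤ σ)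
    (hγ₁ : 0 ≤ γ₁) (hδ₁ : 0 ≤ δ₁) (ht : t ∈ Icc 0 T) :
    |fourierEnergy γ₁ δ₁ σ (g t) - fourierEnergy γ₁ δ₁ σ (g 0)|
      ≤ ∫ r in (0 : ℝ)..t, min 1 σ ^ 2 * (fluxConst (7 / 48)
        * ((1 + sobNorm 2 (coshSymbol σ • g r)) * sobNorm 2 (coshSymbol σ • g r) ^ 3)) := by
  have hsub : Icc 0 t ⊆ Icc 0 T := Icc_subset_Icc_right ht.2
  rw [S.fourierEnergy_sub hσ hγ₁ hδ₁ ht, ← Real.norm_eq_abs]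
  refine intervalIntegral.norm_integral_le_of_norm_le ht.1 (ae_of_all _ fun r hr => ?_) ?_
  · have hr' := hsub (Ioc_subset_Icc_self hr)
    have hre : ∫ ξ, (flux σ (7 / 48) (g r) ξ).re = (∫ ξ, flux σ (7 / 48) (g r) ξ).re :=
      integral_re (S.hasL1Bound_flux hσ hr').integrable
    rw [hre]
    exact (Complex.abs_re_le_norm _).trans (norm_integral_flux_le hσ (S.mem r hr') (S.herm r hr'))
  · refine ContinuousOn.intervalIntegrable ?_
    rw [uIcc_of_le ht.1]
    have hX := S.continuousOn_sobNorm.mono hsub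
    exact (((hX.const_add 1).mul (hX.pow 3)).const_mul _).const_mul _

end FourierSolution

/-! ### Passage to the Fourier side -/

section Bridge

variable {σ : ℝ} {f : L2}

theorem cosh_mul_abs_freq (σ ξ : ℝ) : Real.cosh (σ * |freq ξ|) = coshSymbol σ ξ := by
  rw [coshSymbol, ← Real.cosh_abs (σ * freq ξ), ← Real.cosh_abs, abs_mul, abs_mul, abs_abs]

theorem weight_two_mul (σ : ℝ) (g : ℝ → ℂ) :
    (fun ξ => (weight σ 2 (2 * Real.pi * ξ) : ℂ) * g ξ) = bracket ^ 2 • coshSymbol σ • g := by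
  funext ξ
  rw [weight, ← freq, cosh_mul_abs_freq, Real.rpow_two, ← bracket]
  simp only [Pi.smul_apply', Pi.pow_apply, Complex.real_smul, Complex.ofReal_mul]
  ring

theorem MemH.memSob (hf : MemH σ 2 f) : MemSob 2 (coshSymbol σ • (hat f : ℝ → ℂ)) := by
  rw [MemSob, ← weight_two_mul]
  exact hf

theorem normH_two_of_ae_eq {g : ℝ → ℂ} (h : hat f =ᵐ[volume] g) :
    normH σ 2 f = sobNorm 2 (coshSymbol σ • g) := by
  have hg : AEStronglyMeasurable (bracket ^ 2 • coshSymbol σ • g) volume :=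
    (continuous_bracket.pow 2).aestronglyMeasurable.smul
      ((continuous_coshSymbol σ).aestronglyMeasurable.smul ((Lp.aestronglyMeasurable _).congr h))
  rw [normH, sobNorm, ← toReal_eLpNorm hg, ← weight_two_mul]
  exact congrArg _ (eLpNorm_congr_ae (h.mono fun ξ hξ => by simp only [hξ]))

theorem hat_dx_ae (hf : MemSob 1 (hat f)) :
    hat (dx f) =ᵐ[volume] fun ξ => Complex.I * (freq • (hat f : ℝ → ℂ)) ξ := by
  have hmul : (fun ξ => Complex.I * ((2 * Real.pi * ξ : ℝ) : ℂ) * hat f ξ)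
      = fun ξ => Complex.I * (freq • (hat f : ℝ → ℂ)) ξ := funext fun ξ => mul_assoc _ _ _
  have hdom : InDomain (fun ξ => Complex.I * ξ) f := by
    rw [InDomain, hmul]
    exact hf.memLp_freq_smul.const_mul Complex.I
  rw [← hmul]
  exact hat_multiplier (by simp) hdom

theorem norm_hat_dx_ae (hf : MemSob 1 (hat f)) :
    ∀ᵐ ξ, ‖hat (dx f) ξ‖ = ‖(freq • (hat f : ℝ → ℂ)) ξ‖ := by
  filter_upwards [hat_dx_ae hf] with ξ hξ
  rw [hξ, norm_mul, Complex.norm_I, one_mul]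

theorem memSob_hat_dx {s : ℕ} (hf : MemSob (s + 1) (hat f)) : MemSob s (hat (dx f)) := by
  refine MemLp.congr_norm hf.freq_smul
    ((continuous_bracket.pow s).aestronglyMeasurable.smul (Lp.aestronglyMeasurable _)) ?_
  filter_upwards [norm_hat_dx_ae (hf.mono (Nat.le_add_left 1 s))] with ξ hξ
  rw [norm_bracket_pow_smul, norm_bracket_pow_smul, hξ]

theorem hasFourier_dx (hf : MemSob 2 (hat f)) :
    HasFourier (dx f) fun ξ => Complex.I * (freq • (hat f : ℝ → ℂ)) ξ := by
  have h := hasFourier_hat (memSob_hat_dx hf).integrable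
  have hae := hat_dx_ae (hf.mono one_le_two)
  refine ⟨h.1.congr hae, h.2.mono fun x hx => hx.trans ?_⟩
  rw [Real.fourierInv_eq, Real.fourierInv_eq]
  exact integral_congr_ae (hae.mono fun ξ hξ => congrArg _ hξ)

theorem integral_add_const_mul_add_const_mul {α : Type*} [MeasurableSpace α] {μ : Measure α}
    {u v w : α → ℝ} (hu : Integrable u μ) (hv : Integrable v μ) (hw : Integrable w μ) (a b : ℝ) :
    ∫ x, (u x + a * v x + b * w x) ∂μ = ∫ x, u x ∂μ + a * ∫ x, v x ∂μ + b * ∫ x, w x ∂μ := by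
  rw [integral_add (by exact hu.add (hv.const_mul a)) (hw.const_mul b),
    integral_add hu (hv.const_mul a), integral_const_mul, integral_const_mul]

theorem integral_energy_density_eq (γ₁ δ₁ : ℝ) (hf : MemSob 2 (hat f)) :
    ∫ x, (f x ^ 2 + γ₁ * dx f x ^ 2 + δ₁ * dx (dx f) x ^ 2)
      = ∫ ξ, symb γ₁ δ₁ ξ * ‖hat f ξ‖ ^ 2 := by
  have hsq : ∀ u : L2, Integrable fun x => u x ^ 2 := fun u => (Lp.memLp u).integrable_sq
  have hhat : ∀ u : L2, Integrable fun ξ => ‖hat u ξ‖ ^ 2 := fun u =>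
    (Lp.memLp (hat u)).integrable_norm_pow two_ne_zero
  rw [integral_add_const_mul_add_const_mul (hsq _) (hsq _) (hsq _), integral_sq_eq_integral_hat,
    integral_sq_eq_integral_hat, integral_sq_eq_integral_hat,
    ← integral_add_const_mul_add_const_mul (hhat _) (hhat _) (hhat _)]
  refine integral_congr_ae ?_
  filter_upwards [norm_hat_dx_ae (hf.mono one_le_two), norm_hat_dx_ae (memSob_hat_dx hf)]
    with ξ h₁ h₂
  simp only [h₂, h₁, Pi.smul_apply', norm_smul, mul_pow, Real.norm_eq_abs, sq_abs, symb]
  ring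

theorem hat_coshD_ae (hf : MemLp (coshSymbol σ • (hat f : ℝ → ℂ)) 2) :
    hat (coshD σ f) =ᵐ[volume] coshSymbol σ • (hat f : ℝ → ℂ) := by
  have hmul : (fun ξ => ((Real.cosh (σ * |2 * Real.pi * ξ|) : ℝ) : ℂ) * hat f ξ)
      = coshSymbol σ • (hat f : ℝ → ℂ) := funext fun ξ => by
    rw [← freq, cosh_mul_abs_freq]
    rfl
  have hdom : InDomain (fun ξ => ((Real.cosh (σ * |ξ|) : ℝ) : ℂ)) f := by
    rw [InDomain, hmul]
    exact hf
  rw [← hmul]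
  exact hat_multiplier (fun ξ => by rw [abs_neg, Complex.conj_ofReal]) hdom

theorem energy_eq_fourierEnergy (γ₁ δ₁ : ℝ) (hf : MemH σ 2 f) :
    energy γ₁ δ₁ σ f = fourierEnergy γ₁ δ₁ σ (hat f) := by
  have hae := hat_coshD_ae hf.memSob.memLp
  have hmem : MemSob 2 (hat (coshD σ f)) :=
    MemLp.ae_eq (hae.mono fun ξ hξ => congrArg ((bracket ^ 2) ξ • ·) hξ.symm) hf.memSob
  rw [energy, integral_energy_density_eq γ₁ δ₁ hmem, fourierEnergy]
  exact congrArg _ (integral_congr_ae (hae.mono fun ξ hξ => by simp only [hξ]))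

theorem fourierSolution {γ γ₁ γ₂ δ₁ δ₂ T : ℝ} {η₀ : L2} {η : ℝ → L2} (hcont : ContInH σ 2 T η)
    (hsol : IsSolution γ γ₁ γ₂ δ₁ δ₂ T η₀ η) :
    FourierSolution σ γ γ₁ γ₂ δ₁ δ₂ T (fun t => hat (η t)) where
  mem t ht := (hcont t ht).1.memSob
  tendsto t ht := (hcont t ht).2.congr fun r => normH_two_of_ae_eq <| by
    rw [hat_sub]
    exact Lp.coeFn_sub _ _
  herm t _ := hat_neg_ae (η t)
  hasDeriv θ t ht := by
    have hmem : ∀ r ∈ Icc 0 T, MemSob 2 (hat (η r)) := fun r hr =>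
      (hcont r hr).1.memSob.of_coshSymbol_smul le_rfl
    exact hsol.hasDerivWithinAt_hat
      (fun r hr => hasFourier_hat ((hmem r hr).mono one_le_two).integrable) ht
      (hmem t ht).freq_smul.integrable (hasFourier_dx (hmem t ht)) θ

end Bridge

/-! ### The continuity argument -/

section Bootstrap

variable {X F Φ : ℝ → ℝ} {A R T c₁ c₂ e κ t : ℝ}

theorem integral_comp_le_mul (ht : t ∈ Icc 0 T) (hX : ContinuousOn X (Icc 0 T))
    (hX₀ : ∀ r ∈ Icc 0 T, 0 ≤ X r) (hF : Continuous F) (hF_mono : MonotoneOn F (Ici 0))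
    (hF₀ : 0 ≤ F 0) (hR : 0 ≤ R) (hXR : ∀ r ∈ Ioo 0 t, X r ≤ R) :
    ∫ r in (0 : ℝ)..t, F (X r) ≤ T * F R := by
  have hsub : Icc 0 t ⊆ Icc 0 T := Icc_subset_Icc_right ht.2
  have hint : IntervalIntegrable (fun r => F (X r)) volume 0 t := by
    refine ContinuousOn.intervalIntegrable ?_
    rw [uIcc_of_le ht.1]
    exact hF.comp_continuousOn (hX.mono hsub)
  calc ∫ r in (0 : ℝ)..t, F (X r) ≤ ∫ _ in (0 : ℝ)..t, F R :=
        intervalIntegral.integral_mono_on_of_le_Ioo ht.1 hint intervalIntegrable_const fun r hr =>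
          hF_mono (hX₀ r (hsub (Ioo_subset_Icc_self hr))) hR (hXR r hr)
    _ = t * F R := by rw [intervalIntegral.integral_const, sub_zero, smul_eq_mul]
    _ ≤ T * F R := mul_le_mul_of_nonneg_right ht.2 (hF₀.trans (hF_mono self_mem_Ici hR hR))

theorem lt_of_le_add_integral (hX : ContinuousOn X (Icc 0 T)) (hX₀ : ∀ t ∈ Icc 0 T, 0 ≤ X t)
    (hF : Continuous F) (hF_mono : MonotoneOn F (Ici 0)) (hF₀ : 0 ≤ F 0)
    (hΦ : MonotoneOn Φ (Ici 0)) (hR : X 0 < R)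
    (hle : ∀ t ∈ Icc 0 T, Φ (X t) ≤ e + ∫ r in (0 : ℝ)..t, F (X r))
    (hlt : e + T * F R < Φ R) : ∀ t ∈ Icc 0 T, X t < R := by
  by_contra! hcon
  have hK : IsCompact (Icc 0 T ∩ X ⁻¹' Ici R) :=
    isCompact_Icc.of_isClosed_subset (hX.preimage_isClosed_of_isClosed isClosed_Icc isClosed_Ici)
      inter_subset_left
  obtain ⟨t, ⟨ht, hRt⟩, hmin⟩ := hK.exists_isLeast hcon
  have hR₀ : 0 ≤ R := (hX₀ 0 ⟨le_rfl, ht.1.trans ht.2⟩).trans hR.le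
  have hXR : ∀ r ∈ Ioo 0 t, X r ≤ R := fun r hr => by
    by_contra! h
    exact absurd (hmin ⟨⟨hr.1.le, hr.2.le.trans ht.2⟩, h.le⟩) (not_le.2 hr.2)
  have hint := integral_comp_le_mul ht hX hX₀ hF hF_mono hF₀ hR₀ hXR
  have hΦR : Φ R ≤ Φ (X t) := hΦ hR₀ (hX₀ t ht) hRt
  linarith [hle t ht]

theorem one_add_mul_mul_pow_three_le {q s : ℝ} (hq : 0 ≤ q) (hs : 0 ≤ s) :
    (1 + q * s) * (q * s) ^ 3 ≤ (1 + q) * q ^ 3 * ((1 + s) * s ^ 3) := by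
  have h : 1 + q * s ≤ (1 + q) * (1 + s) := by linarith
  calc (1 + q * s) * (q * s) ^ 3 ≤ (1 + q) * (1 + s) * (q * s) ^ 3 := by gcongr
    _ = (1 + q) * q ^ 3 * ((1 + s) * s ^ 3) := by ring

theorem monotoneOn_const_mul_one_add_mul_pow_three (hA : 0 ≤ A) :
    MonotoneOn (fun x => A * ((1 + x) * x ^ 3)) (Ici 0) := fun x hx y hy hxy => by
  have hx₀ : 0 ≤ x := hx
  have hy₀ : 0 ≤ y := hy
  dsimp only
  gcongr

theorem mul_growth_le_mul_sq {x y : ℝ} (hA : 0 ≤ A) (hc₁ : 0 ≤ c₁) (hκ : 0 ≤ κ) (hx : 0 ≤ x)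
    (hy : 0 ≤ y) (hyx : y ≤ 1 + x)
    (hT : T ≤ c₁ / (2 * (A * ((1 + κ) * κ ^ 3)) + 1) * ((1 + x) ^ 2)⁻¹) :
    T * (A * ((1 + κ * y) * (κ * y) ^ 3)) ≤ c₁ * y ^ 2 := by
  set D := A * ((1 + κ) * κ ^ 3)
  have hD₀ : 0 ≤ D := by positivity
  have hquad : (1 + y) * y ≤ 2 * (1 + x) ^ 2 := by nlinarith
  have hgrowth : A * ((1 + κ * y) * (κ * y) ^ 3) ≤ (2 * D + 1) * (1 + x) ^ 2 * y ^ 2 :=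
    calc A * ((1 + κ * y) * (κ * y) ^ 3) ≤ A * ((1 + κ) * κ ^ 3 * ((1 + y) * y ^ 3)) := by
          gcongr A * ?_
          exact one_add_mul_mul_pow_three_le hκ hy
      _ = D * ((1 + y) * y) * y ^ 2 := by ring
      _ ≤ D * (2 * (1 + x) ^ 2) * y ^ 2 := by gcongr
      _ ≤ (2 * D + 1) * (1 + x) ^ 2 * y ^ 2 := by
          rw [← mul_assoc, mul_comm D]
          gcongr
          exact le_add_of_nonneg_right zero_le_one
  calc T * (A * ((1 + κ * y) * (κ * y) ^ 3))
      ≤ c₁ / (2 * D + 1) * ((1 + x) ^ 2)⁻¹ * ((2 * D + 1) * (1 + x) ^ 2 * y ^ 2) := by gcongr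
    _ = c₁ * y ^ 2 := by field_simp

theorem le_mul_of_sq_le_add_integral (hX : ContinuousOn X (Icc 0 T))
    (hX₀ : ∀ t ∈ Icc 0 T, 0 ≤ X t) (hA : 0 ≤ A) (hc₁ : 0 ≤ c₁) (hc₂ : 0 < c₂) (hκ : 1 ≤ κ)
    (hcκ : c₁ + c₂ ≤ c₁ * κ ^ 2) (he : e ≤ c₂ * X 0 ^ 2)
    (hle : ∀ t ∈ Icc 0 T, c₁ * X t ^ 2 ≤ e + ∫ r in (0 : ℝ)..t, A * ((1 + X r) * X r ^ 3))
    (hT : T ≤ c₁ / (2 * (A * ((1 + κ) * κ ^ 3)) + 1) * ((1 + X 0) ^ 2)⁻¹) :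
    ∀ t ∈ Icc 0 T, X t ≤ κ * X 0 := by
  intro t ht
  have hκ₀ : 0 < κ := one_pos.trans_le hκ
  have hx : 0 ≤ X 0 := hX₀ 0 ⟨le_rfl, ht.1.trans ht.2⟩
  have hlt : ∀ y, X 0 < y → y ≤ 1 + X 0 → X t < κ * y := fun y hxy hy => by
    have hy₀ : 0 < y := hx.trans_lt hxy
    refine lt_of_le_add_integral (Φ := fun x => c₁ * x ^ 2) (e := e) hX hX₀ (by fun_prop)
      (monotoneOn_const_mul_one_add_mul_pow_three hA) (by norm_num) (fun u hu v _ huv => ?_)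
      (hxy.trans_le (le_mul_of_one_le_left hy₀.le hκ)) hle ?_ t ht
    · exact mul_le_mul_of_nonneg_left (pow_le_pow_left₀ hu huv 2) hc₁
    · calc e + T * (A * ((1 + κ * y) * (κ * y) ^ 3)) ≤ c₂ * X 0 ^ 2 + c₁ * y ^ 2 :=
            add_le_add he (mul_growth_le_mul_sq hA hc₁ hκ₀.le hx hy₀.le hy hT)
        _ < c₂ * y ^ 2 + c₁ * y ^ 2 := by gcongr
        _ = (c₁ + c₂) * y ^ 2 := by ring
        _ ≤ c₁ * κ ^ 2 * y ^ 2 := by gcongr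
        _ = c₁ * (κ * y) ^ 2 := by ring
  rw [← div_le_iff₀' hκ₀]
  refine le_of_forall_gt_imp_ge_of_dense fun y hxy => ?_
  have hmin := hlt (min y (1 + X 0)) (lt_min hxy (lt_one_add _)) (min_le_right _ _)
  rw [div_le_iff₀' hκ₀]
  exact hmin.le.trans (mul_le_mul_of_nonneg_left (min_le_left _ _) hκ₀.le)

end Bootstrap

/-! ### Almost conservation -/

/-- The factor by which the Sobolev norm of a solution can grow on the time interval of the
theorem. -/
def growthConst (γ₁ δ₁ : ℝ) : ℝ := 1 + (1 + γ₁ + δ₁) / ellConst γ₁ δ₁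

/-- The constant `c₀` of the theorem. -/
def timeConst (γ₁ δ₁ : ℝ) : ℝ :=
  ellConst γ₁ δ₁ / 2
    / (2 * (fluxConst (7 / 48) * ((1 + growthConst γ₁ δ₁) * growthConst γ₁ δ₁ ^ 3)) + 1)

/-- The ratio between the Sobolev norm of a solution on the time interval of the theorem and the
square root of its initial energy. -/
def normConst (γ₁ δ₁ : ℝ) : ℝ := growthConst γ₁ δ₁ * √(2 / ellConst γ₁ δ₁)

/-- The constant `C` of the theorem. -/
def energyConst (γ₁ δ₁ : ℝ) : ℝ :=
  fluxConst (7 / 48) * ((1 + normConst γ₁ δ₁) * normConst γ₁ δ₁ ^ 3) + 1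

section Conservation

variable {σ γ₁ γ₂ δ₁ δ₂ T t : ℝ} {g : ℝ → ℝ → ℂ}

theorem one_le_growthConst (hγ₁ : 0 < γ₁) (hδ₁ : 0 < δ₁) : 1 ≤ growthConst γ₁ δ₁ :=
  le_add_of_nonneg_right (div_nonneg (by positivity) (ellConst_pos hγ₁ hδ₁).le)

theorem growthConst_pos (hγ₁ : 0 < γ₁) (hδ₁ : 0 < δ₁) : 0 < growthConst γ₁ δ₁ :=
  one_pos.trans_le (one_le_growthConst hγ₁ hδ₁)

theorem ellConst_add_le_mul_sq_growthConst (hγ₁ : 0 < γ₁) (hδ₁ : 0 < δ₁) :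
    ellConst γ₁ δ₁ / 2 + (1 + γ₁ + δ₁) / 2 ≤ ellConst γ₁ δ₁ / 2 * growthConst γ₁ δ₁ ^ 2 := by
  have hell := ellConst_pos hγ₁ hδ₁
  calc ellConst γ₁ δ₁ / 2 + (1 + γ₁ + δ₁) / 2 = ellConst γ₁ δ₁ / 2 * growthConst γ₁ δ₁ := by
        unfold growthConst
        field_simp
    _ ≤ ellConst γ₁ δ₁ / 2 * growthConst γ₁ δ₁ ^ 2 := by
        gcongr
        exact le_self_pow₀ (one_le_growthConst hγ₁ hδ₁) two_ne_zero

theorem timeConst_pos (hγ₁ : 0 < γ₁) (hδ₁ : 0 < δ₁) : 0 < timeConst γ₁ δ₁ := by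
  have hell := ellConst_pos hγ₁ hδ₁
  have hκ := growthConst_pos hγ₁ hδ₁
  have hA := fluxConst_nonneg (7 / 48)
  unfold timeConst
  positivity

theorem normConst_nonneg (hγ₁ : 0 < γ₁) (hδ₁ : 0 < δ₁) : 0 ≤ normConst γ₁ δ₁ :=
  mul_nonneg (growthConst_pos hγ₁ hδ₁).le (Real.sqrt_nonneg _)

theorem energyConst_pos (hγ₁ : 0 < γ₁) (hδ₁ : 0 < δ₁) : 0 < energyConst γ₁ δ₁ := by
  have hq := normConst_nonneg hγ₁ hδ₁
  have hA := fluxConst_nonneg (7 / 48)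
  unfold energyConst
  positivity

theorem sobNorm_le_mul_sqrt_fourierEnergy {a : ℝ → ℂ} (hγ₁ : 0 < γ₁) (hδ₁ : 0 < δ₁)
    (ha : MemSob 2 (coshSymbol σ • a)) :
    sobNorm 2 (coshSymbol σ • a) ≤ √(2 / ellConst γ₁ δ₁) * √(fourierEnergy γ₁ δ₁ σ a) := by
  have hell := ellConst_pos hγ₁ hδ₁
  rw [← Real.sqrt_mul (by positivity)]
  refine Real.le_sqrt_of_sq_le ?_
  rw [div_mul_eq_mul_div, le_div_iff₀ hell]
  linarith [ellConst_mul_sq_sobNorm_le hγ₁.le hδ₁.le ha]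

namespace FourierSolution

theorem sobNorm_le_growthConst_mul (S : FourierSolution σ (7 / 48) γ₁ γ₂ δ₁ δ₂ T g) (hσ : 0 ≤ σ)
    (hγ₁ : 0 < γ₁) (hδ₁ : 0 < δ₁)
    (hT : T ≤ timeConst γ₁ δ₁ * ((1 + sobNorm 2 (coshSymbol σ • g 0)) ^ 2)⁻¹) :
    ∀ t ∈ Icc 0 T,
      sobNorm 2 (coshSymbol σ • g t) ≤ growthConst γ₁ δ₁ * sobNorm 2 (coshSymbol σ • g 0) := by
  intro t ht
  have h₀ : (0 : ℝ) ∈ Icc 0 T := ⟨le_rfl, ht.1.trans ht.2⟩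
  have hA := fluxConst_nonneg (7 / 48)
  refine le_mul_of_sq_le_add_integral (A := fluxConst (7 / 48)) S.continuousOn_sobNorm
    (fun _ _ => sobNorm_nonneg) hA (half_pos (ellConst_pos hγ₁ hδ₁)).le (by positivity)
    (one_le_growthConst hγ₁ hδ₁) (ellConst_add_le_mul_sq_growthConst hγ₁ hδ₁)
    (fourierEnergy_le hγ₁.le hδ₁.le (S.mem 0 h₀)) (fun s hs => ?_) hT t ht
  have hdrift := (le_abs_self _).trans (S.abs_fourierEnergy_sub_le hσ hγ₁.le hδ₁.le hs)
  rw [intervalIntegral.integral_const_mul] at hdrift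
  have hint : 0 ≤ ∫ r in (0 : ℝ)..s, fluxConst (7 / 48)
      * ((1 + sobNorm 2 (coshSymbol σ • g r)) * sobNorm 2 (coshSymbol σ • g r) ^ 3) :=
    intervalIntegral.integral_nonneg hs.1 fun r _ => by
      have hX := sobNorm_nonneg (s := 2) (f := coshSymbol σ • g r)
      positivity
  have hmin : min 1 σ ^ 2 ≤ 1 := pow_le_one₀ (le_min zero_le_one hσ) (min_le_left _ _)
  linarith [ellConst_mul_sq_sobNorm_le hγ₁.le hδ₁.le (S.mem s hs), mul_le_of_le_one_left hint hmin]

theorem abs_fourierEnergy_sub_le_mul (S : FourierSolution σ (7 / 48) γ₁ γ₂ δ₁ δ₂ T g)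
    (hσ : 0 ≤ σ) (hγ₁ : 0 ≤ γ₁) (hδ₁ : 0 ≤ δ₁) (ht : t ∈ Icc 0 T) {R : ℝ}
    (hR : ∀ r ∈ Icc 0 T, sobNorm 2 (coshSymbol σ • g r) ≤ R) :
    |fourierEnergy γ₁ δ₁ σ (g t) - fourierEnergy γ₁ δ₁ σ (g 0)|
      ≤ σ ^ 2 * (T * (fluxConst (7 / 48) * ((1 + R) * R ^ 3))) := by
  have hA := fluxConst_nonneg (7 / 48)
  have hR₀ : 0 ≤ R := sobNorm_nonneg.trans (hR t ht)
  have hT : 0 ≤ T := ht.1.trans ht.2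
  refine (S.abs_fourierEnergy_sub_le hσ hγ₁ hδ₁ ht).trans ?_
  rw [intervalIntegral.integral_const_mul]
  have hmin : min 1 σ ^ 2 ≤ σ ^ 2 :=
    pow_le_pow_left₀ (le_min zero_le_one hσ) (min_le_right _ _) 2
  refine mul_le_mul_of_nonneg hmin ?_ (sq_nonneg _) (by positivity)
  exact integral_comp_le_mul (F := fun x => fluxConst (7 / 48) * ((1 + x) * x ^ 3)) ht
    S.continuousOn_sobNorm (fun _ _ => sobNorm_nonneg) (by fun_prop)
    (monotoneOn_const_mul_one_add_mul_pow_three hA) (by norm_num) hR₀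
    fun r hr => hR r ⟨hr.1.le, hr.2.le.trans ht.2⟩

theorem abs_fourierEnergy_sub_le_energyConst_mul
    (S : FourierSolution σ (7 / 48) γ₁ γ₂ δ₁ δ₂ T g) (hσ : 0 ≤ σ) (hγ₁ : 0 < γ₁) (hδ₁ : 0 < δ₁)
    (hT : T ≤ timeConst γ₁ δ₁ * ((1 + sobNorm 2 (coshSymbol σ • g 0)) ^ 2)⁻¹)
    (ht : t ∈ Icc 0 T) :
    |fourierEnergy γ₁ δ₁ σ (g t) - fourierEnergy γ₁ δ₁ σ (g 0)|
      ≤ energyConst γ₁ δ₁ * (σ ^ 2 * T * ((1 + √(fourierEnergy γ₁ δ₁ σ (g 0)))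
        * √(fourierEnergy γ₁ δ₁ σ (g 0)) ^ 3)) := by
  set q := normConst γ₁ δ₁ with hq
  set s := √(fourierEnergy γ₁ δ₁ σ (g 0))
  have hs₀ : 0 ≤ s := Real.sqrt_nonneg _
  have hT₀ : 0 ≤ T := ht.1.trans ht.2
  have hA := fluxConst_nonneg (7 / 48)
  have hX : ∀ r ∈ Icc 0 T, sobNorm 2 (coshSymbol σ • g r) ≤ q * s := fun r hr => by
    rw [hq, normConst, mul_assoc]
    exact (S.sobNorm_le_growthConst_mul hσ hγ₁ hδ₁ hT r hr).trans <|
      mul_le_mul_of_nonneg_left (sobNorm_le_mul_sqrt_fourierEnergy hγ₁ hδ₁ (S.mem 0 ⟨le_rfl, hT₀⟩))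
        (growthConst_pos hγ₁ hδ₁).le
  calc |fourierEnergy γ₁ δ₁ σ (g t) - fourierEnergy γ₁ δ₁ σ (g 0)|
      ≤ σ ^ 2 * (T * (fluxConst (7 / 48) * ((1 + q * s) * (q * s) ^ 3))) :=
        S.abs_fourierEnergy_sub_le_mul hσ hγ₁.le hδ₁.le ht hX
    _ ≤ σ ^ 2 * (T * (fluxConst (7 / 48) * ((1 + q) * q ^ 3 * ((1 + s) * s ^ 3)))) := by
        gcongr σ ^ 2 * (T * (_ * ?_))
        exact one_add_mul_mul_pow_three_le (normConst_nonneg hγ₁ hδ₁) hs₀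
    _ = fluxConst (7 / 48) * ((1 + q) * q ^ 3) * (σ ^ 2 * T * ((1 + s) * s ^ 3)) := by ring
    _ ≤ energyConst γ₁ δ₁ * (σ ^ 2 * T * ((1 + s) * s ^ 3)) := by
        gcongr
        exact le_add_of_nonneg_right zero_le_one

end FourierSolution

theorem fourierEnergy_nonneg (hγ₁ : 0 ≤ γ₁) (hδ₁ : 0 ≤ δ₁) (σ : ℝ) (a : ℝ → ℂ) :
    0 ≤ fourierEnergy γ₁ δ₁ σ a :=
  mul_nonneg (by norm_num) (integral_nonneg fun ξ =>
    mul_nonneg (symb_pos hγ₁ hδ₁ ξ).le (sq_nonneg _))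

theorem abs_energy_sub_le {η₀ : L2} {η : ℝ → L2} (hσ : 0 ≤ σ) (hγ₁ : 0 < γ₁) (hδ₁ : 0 < δ₁)
    (hT : T ≤ timeConst γ₁ δ₁ * ((1 + normH σ 2 η₀) ^ 2)⁻¹) (hcont : ContInH σ 2 T η)
    (hsol : IsSolution (7 / 48) γ₁ γ₂ δ₁ δ₂ T η₀ η) (ht : t ∈ Icc 0 T) :
    |energy γ₁ δ₁ σ (η t) - energy γ₁ δ₁ σ η₀| ≤ energyConst γ₁ δ₁ * (σ ^ 2 * T *
      ((1 + energy γ₁ δ₁ σ η₀ ^ (1 / 2 : ℝ)) * energy γ₁ δ₁ σ η₀ ^ (3 / 2 : ℝ))) := by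
  rw [← hsol.initial, normH_two_of_ae_eq .rfl] at hT
  have hE₀ := fourierEnergy_nonneg hγ₁.le hδ₁.le σ (hat (η 0))
  rw [← hsol.initial, energy_eq_fourierEnergy γ₁ δ₁ (hcont t ht).1,
    energy_eq_fourierEnergy γ₁ δ₁ (hcont 0 ⟨le_rfl, ht.1.trans ht.2⟩).1,
    Real.rpow_div_two_eq_sqrt 1 hE₀, Real.rpow_div_two_eq_sqrt 3 hE₀, Real.rpow_one,
    Real.rpow_ofNat]
  exact (fourierSolution hcont hsol).abs_fourierEnergy_sub_le_energyConst_mul hσ hγ₁ hδ₁ hT ht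

end Conservation

theorem exists_isLUB_image_abs_sub_le {α : Type*} {f : α → ℝ} {s : Set α} {a : α} {b : ℝ}
    (ha : a ∈ s) (hb : ∀ t ∈ s, |f t - f a| ≤ b) :
    ∃ S, IsLUB (f '' s) S ∧ |S - f a| ≤ b := by
  have hub : f a + b ∈ upperBounds (f '' s) := forall_mem_image.2 fun t ht =>
    sub_le_iff_le_add'.1 (le_of_abs_le (hb t ht))
  have hlub := isLUB_csSup ((nonempty_of_mem ha).image f) ⟨_, hub⟩
  refine ⟨_, hlub, ?_⟩
  rw [abs_of_nonneg (sub_nonneg.2 (hlub.1 (mem_image_of_mem f ha)))]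
  exact sub_le_iff_le_add'.2 (hlub.2 hub)

end KdVBBM

end

open KdVBBM in
theorem theorem3 (γ₁ γ₂ δ₁ δ₂ : ℝ) (hγ₁ : 0 < γ₁) (hδ₁ : 0 < δ₁) :
    ∃ c₀ C : ℝ, 0 < c₀ ∧ 0 < C ∧
      ∀ (σ T : ℝ) (η₀ : KdVBBM.L2) (η : ℝ → KdVBBM.L2),
        0 ≤ σ → KdVBBM.MemH σ 2 η₀ →
        0 < T → T ≤ c₀ * ((1 + KdVBBM.normH σ 2 η₀) ^ 2)⁻¹ →
        KdVBBM.ContInH σ 2 T η →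
        KdVBBM.IsSolution (7 / 48) γ₁ γ₂ δ₁ δ₂ T η₀ η →
        ∃ S : ℝ,
          IsLUB ((fun t => KdVBBM.energy γ₁ δ₁ σ (η t)) '' Set.Icc 0 T) S ∧
          |S - KdVBBM.energy γ₁ δ₁ σ η₀| ≤
            C * (σ ^ 2 * T *
              ((1 + KdVBBM.energy γ₁ δ₁ σ η₀ ^ (1 / 2 : ℝ)) *
                KdVBBM.energy γ₁ δ₁ σ η₀ ^ (3 / 2 : ℝ))) := by
  refine ⟨timeConst γ₁ δ₁, energyConst γ₁ δ₁, timeConst_pos hγ₁ hδ₁, energyConst_pos hγ₁ hδ₁,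
    fun σ T η₀ η hσ _ hT hsmall hcont hsol => ?_⟩
  have hdrift := fun t => abs_energy_sub_le (t := t) hσ hγ₁ hδ₁ hsmall hcont hsol
  rw [← hsol.initial] at hdrift ⊢
  exact exists_isLUB_image_abs_sub_le (f := fun t => energy γ₁ δ₁ σ (η t)) ⟨le_rfl, hT.le⟩ hdrift
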